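/- **Theorem (center of the universal comodule algebra for the Sweedler algebra).** Let $k$ be an infinite field of characteristic different from $2$, and let $H=H_4$ be the Sweedler Hopf algebra: it is generated by $x,y$ with $x^2=1$, $y^2=0$, $xy+yx=0$, has basis $1,x,y,z=xy$, and $\Delta(x)=x\otimes x$, $\Delta(y)=1\otimes y+y\otimes x$, $\varepsilon(x)=1$, $\varepsilon(y)=0$. Let $\alpha$ be a normalized convolution-invertible two-cocycle on $H$ and let ${}^{\alpha}H$ be the twisted $H$-comodule algebra: it has underlying space $\{u_h : h\in H\}$, product $u_gu_h=\alpha(g_1,h_1)\,u_{g_2h_2}$ and coaction $u_h\mapsto u_{h_1}\otimes h_2$. Let $a,b,c\in k$ with $a\neq 0$ be such that ${}^{\alpha}H$ is isomorphic, as an $H$-comodule algebra, to $$A_{a,b,c}=k\langle u_x,u_y \mid u_x^2=a,\ u_xu_y+u_yu_x=b,\ u_y^2=c\rangle,\qquad u_x\mapsto u_x\otimes x,\quad u_y\mapsto 1\otimes y+u_y\otimes x .$$ Let $T(X_H)$ be the tensor algebra on a copy $\{X_h : h\in H\}$ of $H$, with coaction $X_h\mapsto X_{h_1}\otimes h_2$.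 Let $I$ be the intersection of the kernels of all $H$-comodule algebra maps $T(X_H)\to{}^{\alpha}H$, let $\mathcal U_H^{\alpha}=T(X_H)/I$, and let $\mathcal Z_H^{\alpha}$ be the center of $\mathcal U_H^{\alpha}$. Write $X=X_x$, $Y=X_y$, $Z=X_z$ and $$E=X_1,\quad R=X^2,\quad S=Y^2,\quad T=XY+YX,\quad U=X(XZ+ZX),$$ and use the same letters for the classes of these elements in $\mathcal U_H^{\alpha}$. Let $S(t_H)$ be the symmetric algebra on a copy $\{t_h : h\in H\}$ of $H$, and let $h\mapsto t^{-1}_h\in\operatorname{Frac}S(t_H)$ be the convolution inverse of $h\mapsto t_h$. Let $\mathcal B_H^{\alpha}$ be the subalgebra of $\operatorname{Frac}S(t_H)$ generated by all elements $$\sigma(g,h)=t_{g_1}t_{h_1}\,\alpha(g_2,h_2)\,t^{-1}_{g_3h_3},\qquad \sigma^{-1}(g,h)=t_{g_1h_1}\,\alpha^{-1}(g_2,h_2)\,t^{-1}_{g_3}t^{-1}_{h_3}\qquad(g,h\in H).$$ Finally, let $\mu_\alpha:T(X_H)\to S(t_H)\otimes{}^{\alpha}H$ be the algebra map with $\mu_\alpha(X_h)=t_{h_1}\otimes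 u_{h_2}$. Then $E,R,S,T,U$ lie in $\mathcal Z_H^{\alpha}$, and the following hold. 1. There is an isomorphism of $k$-algebras $$\mathcal Z_H^{\alpha}[E^{-1},R^{-1}]\;\cong\; k[E,E^{-1},R,R^{-1},S,T,U]/(D_{a,b,c}),\qquad D_{a,b,c}=T^2-4RS-\frac{b^2-4ac}{a}\,E^2R,$$ which sends the elements $E,R,S,T,U$ of $\mathcal Z_H^{\alpha}$ to the classes of the indeterminates of the same name. 2. $\mathcal B_H^{\alpha}=\mathcal Z_H^{\alpha}[E^{-1},R^{-1}]$, where $\mathcal Z_H^{\alpha}$ is mapped to $\operatorname{Frac}S(t_H)$ by $\mu_\alpha$. That is, there is an isomorphism of $k$-algebras $\Psi:\mathcal Z_H^{\alpha}[E^{-1},R^{-1}]\to\mathcal B_H^{\alpha}$ such that $\mu_\alpha(P)=\Psi(\overline P)\otimes u_1$ in $\operatorname{Frac}S(t_H)\otimes{}^{\alpha}H$ for every $P\in T(X_H)$ whose class $\overline P$ in $\mathcal U_H^{\alpha}$ is central. -/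

import Mathlib

open TensorProduct

noncomputable section

/-! ### Comodule algebras, identities and the universal comodule algebra -/

section General

universe u v w w'

/-- A (right) `H`-comodule algebra over `k`: an algebra `A` with a coassociative, counital
coaction `A → A ⊗ H` which is an algebra map. -/
class ComoduleAlgebra (k : Type u) (H : Type v) (A : Type w) [Field k] [Ring H] [HopfAlgebra k H]
    [Ring A] [Algebra k A] where
  coaction : A →ₐ[k] A ⊗[k] H
  coassoc : (Algebra.TensorProduct.assoc k k k A H H).toAlgHom.comp
      ((Algebra.TensorProduct.map coaction (AlgHom.id k H)).comp coaction) =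
    (Algebra.TensorProduct.map (AlgHom.id k A) (Bialgebra.comulAlgHom k H)).comp coaction
  counit : (Algebra.TensorProduct.rid k k A).toAlgHom.comp
      ((Algebra.TensorProduct.map (AlgHom.id k A) (Bialgebra.counitAlgHom k H)).comp coaction) =
    AlgHom.id k A

/-- An algebra map between `H`-comodule algebras which is compatible with the coactions. -/
def IsComoduleAlgHom (k : Type u) (H : Type v) {A : Type w} {B : Type w'} [Field k]
    [Ring H] [HopfAlgebra k H] [Ring A] [Algebra k A] [ComoduleAlgebra k H A]
    [Ring B] [Algebra k B] [ComoduleAlgebra k H B] (f : A →ₐ[k] B) : Prop :=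
  (ComoduleAlgebra.coaction : B →ₐ[k] B ⊗[k] H).comp f =
    (Algebra.TensorProduct.map f (AlgHom.id k H)).comp
      (ComoduleAlgebra.coaction : A →ₐ[k] A ⊗[k] H)

variable (k : Type u) (H : Type v) [Field k] [Ring H] [HopfAlgebra k H]

/-- The tensor algebra `T(X_H)` with coaction `X_x ↦ X_{x₁} ⊗ x₂`, where
`X_x` is `TensorAlgebra.ι k x`. -/
instance TensorAlgebra.instComoduleAlgebra : ComoduleAlgebra k H (TensorAlgebra k H) where
  coaction := TensorAlgebra.lift k
    (TensorProduct.map (TensorAlgebra.ι k) LinearMap.id ∘ₗ Coalgebra.comul)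
  coassoc := by
    ext x
    simp only [AlgHom.toLinearMap_apply, LinearMap.comp_apply, AlgHom.comp_apply,
      TensorAlgebra.lift_ι_apply]
    have h1 : ∀ t : H ⊗[k] H,
        (Algebra.TensorProduct.assoc k k k (TensorAlgebra k H) H H)
          (Algebra.TensorProduct.map (TensorAlgebra.lift k
            (TensorProduct.map (TensorAlgebra.ι k) LinearMap.id ∘ₗ Coalgebra.comul))
            (AlgHom.id k H) (TensorProduct.map (TensorAlgebra.ι k) LinearMap.id t)) =
        TensorProduct.map (TensorAlgebra.ι k) LinearMap.id
          (TensorProduct.assoc k H H H (Coalgebra.comul.rTensor H t)) := by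
      intro t
      induction t with
      | zero => simp
      | add a b ha hb => simp only [map_add, ha, hb]
      | tmul a b =>
        simp only [TensorProduct.map_tmul, Algebra.TensorProduct.map_tmul,
          TensorAlgebra.lift_ι_apply, LinearMap.rTensor_tmul, LinearMap.comp_apply]
        generalize (Coalgebra.comul a : H ⊗[k] H) = s
        induction s with
        | zero => simp
        | add a b ha hb => simp only [map_add, ha, hb, TensorProduct.add_tmul]
        | tmul c d => simp
    have h2 : ∀ t : H ⊗[k] H,
        (Algebra.TensorProduct.map (AlgHom.id k (TensorAlgebra k H)) (Bialgebra.comulAlgHom k H))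
          (TensorProduct.map (TensorAlgebra.ι k) LinearMap.id t) =
        TensorProduct.map (TensorAlgebra.ι k) LinearMap.id (Coalgebra.comul.lTensor H t) := by
      intro t
      induction t with
      | zero => simp
      | add a b ha hb => simp only [map_add, ha, hb]
      | tmul a b => simp
    have := h1 (Coalgebra.comul x)
    rw [Coalgebra.coassoc_apply, ← h2] at this
    exact this
  counit := by
    ext x
    simp only [AlgHom.toLinearMap_apply, LinearMap.comp_apply, AlgHom.comp_apply,
      TensorAlgebra.lift_ι_apply]
    have h : ∀ t : H ⊗[k] H,
        (Algebra.TensorProduct.rid k k (TensorAlgebra k H))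
          (Algebra.TensorProduct.map (AlgHom.id k (TensorAlgebra k H))
            (Bialgebra.counitAlgHom k H) (TensorProduct.map (TensorAlgebra.ι k) LinearMap.id t)) =
        TensorAlgebra.ι k (TensorProduct.rid k H (Coalgebra.counit.lTensor H t)) := by
      intro t
      induction t with
      | zero => simp
      | add a b ha hb => simp only [map_add, ha, hb]
      | tmul a b => simp
    have := h (Coalgebra.comul x)
    rw [Coalgebra.lTensor_counit_comul] at this
    simpa using this

variable (A : Type w) [Ring A] [Algebra k A] [ComoduleAlgebra k H A]

/-- The ideal `I_H(A)` of `H`-identities: the intersection of the kernels of all `H`-comodule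
algebra maps `T(X_H) → A`. -/
def identityIdeal : Ideal (TensorAlgebra k H) :=
  ⨅ μ : {μ : TensorAlgebra k H →ₐ[k] A // IsComoduleAlgHom k H μ}, RingHom.ker μ.1

instance identityIdeal_isTwoSided : (identityIdeal k H A).IsTwoSided where
  mul_mem_of_left b ha := by
    simp only [identityIdeal, Ideal.mem_iInf, RingHom.mem_ker, map_mul] at ha ⊢
    intro μ
    rw [ha μ, zero_mul]

/-- The universal `H`-comodule algebra `U_H(A) = T(X_H) / I_H(A)` attached to `A`. -/
abbrev UniversalComoduleAlgebra : Type (max u v) :=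
  TensorAlgebra k H ⧸ identityIdeal k H A

/-- The projection `T(X_H) → U_H(A)`. -/
def universalMk : TensorAlgebra k H →ₐ[k] UniversalComoduleAlgebra k H A :=
  Ideal.Quotient.mkₐ k (identityIdeal k H A)

/-- The center `Z_H(A)` of `U_H(A)`. -/
abbrev universalCenter : Subalgebra k (UniversalComoduleAlgebra k H A) :=
  Subalgebra.center k (UniversalComoduleAlgebra k H A)

/-! ### Two-cocycles and twisted algebras -/

variable {k H} in
/-- For a bilinear form `α` on `H`, the map `x ⊗ y ↦ α(x₁, y₁) x₂ y₂`. -/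
def twistedMul (α : H ⊗[k] H →ₗ[k] k) : H ⊗[k] H →ₗ[k] H :=
  (TensorProduct.lid k H).toLinearMap ∘ₗ TensorProduct.map α (LinearMap.mul' k H) ∘ₗ
    Coalgebra.comul

/-- A normalized convolution-invertible two-cocycle `α` on `H`, a bilinear form being viewed as a
linear form on `H ⊗ H`. -/
structure TwoCocycle where
  form : H ⊗[k] H →ₗ[k] k
  /-- the convolution inverse of the form -/
  inv : H ⊗[k] H →ₗ[k] k
  form_mul_inv : WithConv.toConv form * WithConv.toConv inv = 1
  inv_mul_form : WithConv.toConv inv * WithConv.toConv form = 1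
  /-- `α(x₁, y₁) α(x₂ y₂, z) = α(y₁, z₁) α(x, y₂ z₂)` -/
  cocycle : ∀ x y z : H,
    form (twistedMul form (x ⊗ₜ y) ⊗ₜ z) = form (x ⊗ₜ twistedMul form (y ⊗ₜ z))
  form_one_right : ∀ x : H, form (x ⊗ₜ 1) = Coalgebra.counit x
  form_one_left : ∀ x : H, form (1 ⊗ₜ x) = Coalgebra.counit x

variable {k H}

/-- `δ(u_x u_y) = α(x₁, y₁) u_{x₂ y₂} ⊗ x₃ y₃`. -/
theorem comul_twistedMul (α : H ⊗[k] H →ₗ[k] k) (t : H ⊗[k] H) :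
    Coalgebra.comul (R := k) (twistedMul α t) =
      TensorProduct.map (twistedMul α) (LinearMap.mul' k H) (Coalgebra.comul t) := by
  set F : (H ⊗[k] H) ⊗[k] ((H ⊗[k] H) ⊗[k] (H ⊗[k] H)) →ₗ[k] H ⊗[k] H :=
    (TensorProduct.lid k (H ⊗[k] H)).toLinearMap ∘ₗ
      TensorProduct.map α (TensorProduct.map (LinearMap.mul' k H) (LinearMap.mul' k H)) with hF
  have h1 : ∀ s : (H ⊗[k] H) ⊗[k] (H ⊗[k] H),
      Coalgebra.comul (R := k)
        (TensorProduct.lid k H (TensorProduct.map α (LinearMap.mul' k H) s)) =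
      F (Coalgebra.comul.lTensor _ s) := by
    intro s
    induction s with
    | zero => simp
    | add a b ha hb => simp only [map_add, ha, hb]
    | tmul a b =>
      have := congrArg (fun f => f b) (Bialgebra.mulCoalgHom k H).map_comp_comul
      simp only [LinearMap.comp_apply] at this
      simp only [hF, TensorProduct.map_tmul, LinearMap.comp_apply, LinearMap.lTensor_tmul,
        LinearEquiv.coe_coe, TensorProduct.lid_tmul, map_smul]
      congr 1
      exact this.symm
  have h2 : ∀ s : (H ⊗[k] H) ⊗[k] (H ⊗[k] H),
      TensorProduct.map (twistedMul α) (LinearMap.mul' k H) s =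
      F (TensorProduct.assoc k _ _ _ (Coalgebra.comul.rTensor _ s)) := by
    intro s
    induction s with
    | zero => simp
    | add a b ha hb => simp only [map_add, ha, hb]
    | tmul a b =>
      simp only [TensorProduct.map_tmul, LinearMap.rTensor_tmul, twistedMul, LinearMap.comp_apply]
      generalize (Coalgebra.comul a : (H ⊗[k] H) ⊗[k] (H ⊗[k] H)) = r
      induction r with
      | zero => simp
      | add a b ha hb => simp only [map_add, ha, hb, TensorProduct.add_tmul]
      | tmul c d => simp [hF, TensorProduct.smul_tmul']
  rw [h2, Coalgebra.coassoc_apply, ← h1]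
  rfl

theorem twistedMul_assoc (α : TwoCocycle k H) (x y z : H) :
    twistedMul α.form (twistedMul α.form (x ⊗ₜ y) ⊗ₜ z) =
      twistedMul α.form (x ⊗ₜ twistedMul α.form (y ⊗ₜ z)) := by
  have key : ∀ X Y Z : H ⊗[k] H,
      TensorProduct.lid k H (TensorProduct.map α.form (LinearMap.mul' k H)
        (TensorProduct.tensorTensorTensorComm k H H H H
          (TensorProduct.map (twistedMul α.form) (LinearMap.mul' k H)
            (TensorProduct.tensorTensorTensorComm k H H H H (X ⊗ₜ Y)) ⊗ₜ Z))) =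
      TensorProduct.lid k H (TensorProduct.map α.form (LinearMap.mul' k H)
        (TensorProduct.tensorTensorTensorComm k H H H H
          (X ⊗ₜ TensorProduct.map (twistedMul α.form) (LinearMap.mul' k H)
            (TensorProduct.tensorTensorTensorComm k H H H H (Y ⊗ₜ Z))))) := by
    intro X Y Z
    induction X with
    | zero => simp
    | add a b ha hb => simp only [map_add, TensorProduct.add_tmul, ha, hb]
    | tmul x1 x2 =>
    induction Y with
    | zero => simp
    | add a b ha hb => simp only [map_add, TensorProduct.add_tmul, TensorProduct.tmul_add, ha, hb]
    | tmul y1 y2 =>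
    induction Z with
    | zero => simp
    | add a b ha hb => simp only [map_add, TensorProduct.tmul_add, ha, hb]
    | tmul z1 z2 => simp [α.cocycle, mul_assoc]
  have h := key (Coalgebra.comul x) (Coalgebra.comul y) (Coalgebra.comul z)
  have e : ∀ a b : H, TensorProduct.tensorTensorTensorComm k H H H H
      (Coalgebra.comul a ⊗ₜ Coalgebra.comul b) = Coalgebra.comul (R := k) (a ⊗ₜ[k] b) :=
    fun a b => rfl
  rw [e, e, ← comul_twistedMul, ← comul_twistedMul, e, e] at h
  exact h

theorem one_twistedMul (α : TwoCocycle k H) (x : H) : twistedMul α.form (1 ⊗ₜ x) = x := by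
  have key : ∀ X : H ⊗[k] H,
      TensorProduct.lid k H (TensorProduct.map α.form (LinearMap.mul' k H)
        (TensorProduct.tensorTensorTensorComm k H H H H ((1 ⊗ₜ 1) ⊗ₜ X))) =
      TensorProduct.lid k H (Coalgebra.counit.rTensor H X) := by
    intro X
    induction X with
    | zero => simp
    | add a b ha hb => simp only [map_add, TensorProduct.tmul_add, ha, hb]
    | tmul x1 x2 => simp [α.form_one_left]
  have h := key (Coalgebra.comul x)
  rw [Coalgebra.rTensor_counit_comul] at h
  have e : TensorProduct.tensorTensorTensorComm k H H H H
      ((1 ⊗ₜ 1) ⊗ₜ Coalgebra.comul x) = Coalgebra.comul (R := k) ((1 : H) ⊗ₜ[k] x) := by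
    rw [TensorProduct.comul_tmul, Bialgebra.comul_one]
    rfl
  rw [e, TensorProduct.lid_tmul, one_smul] at h
  exact h

theorem twistedMul_one (α : TwoCocycle k H) (x : H) : twistedMul α.form (x ⊗ₜ 1) = x := by
  have key : ∀ X : H ⊗[k] H,
      TensorProduct.lid k H (TensorProduct.map α.form (LinearMap.mul' k H)
        (TensorProduct.tensorTensorTensorComm k H H H H (X ⊗ₜ (1 ⊗ₜ 1)))) =
      TensorProduct.lid k H (Coalgebra.counit.rTensor H X) := by
    intro X
    induction X with
    | zero => simp
    | add a b ha hb => simp only [map_add, TensorProduct.add_tmul, ha, hb]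
    | tmul x1 x2 => simp [α.form_one_right]
  have h := key (Coalgebra.comul x)
  rw [Coalgebra.rTensor_counit_comul] at h
  have e : TensorProduct.tensorTensorTensorComm k H H H H
      (Coalgebra.comul x ⊗ₜ (1 ⊗ₜ 1)) = Coalgebra.comul (R := k) (x ⊗ₜ[k] (1 : H)) := by
    rw [TensorProduct.comul_tmul, Bialgebra.comul_one]
    rfl
  rw [e, TensorProduct.lid_tmul, one_smul] at h
  exact h

/-- The underlying space `u_H` of the twisted algebra `ᵅH`. -/
def TwistedAlgebra (_α : TwoCocycle k H) : Type v := H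

namespace TwistedAlgebra

variable (α : TwoCocycle k H)

instance : AddCommGroup (TwistedAlgebra α) := inferInstanceAs (AddCommGroup H)

instance : Module k (TwistedAlgebra α) := inferInstanceAs (Module k H)

/-- The identity map `x ↦ u_x` from `H` to `ᵅH`. -/
def u : H ≃ₗ[k] TwistedAlgebra α := LinearEquiv.refl k H

/-- The product `u_x u_y = α(x₁, y₁) u_{x₂ y₂}`, with unit `u_1`. -/
instance : Ring (TwistedAlgebra α) :=
  { (inferInstance : AddCommGroup (TwistedAlgebra α)) with
    mul := fun p q => u α (twistedMul α.form ((u α).symm p ⊗ₜ (u α).symm q))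
    one := u α 1
    mul_assoc := fun p q r => twistedMul_assoc α p q r
    one_mul := fun p => one_twistedMul α p
    mul_one := fun p => twistedMul_one α p
    zero_mul := fun p => by
      change u α (twistedMul α.form ((u α).symm 0 ⊗ₜ (u α).symm p)) = 0
      simp
    mul_zero := fun p => by
      change u α (twistedMul α.form ((u α).symm p ⊗ₜ (u α).symm 0)) = 0
      simp
    left_distrib := fun p q r => by
      change u α (twistedMul α.form ((u α).symm p ⊗ₜ (u α).symm (q + r))) =
        u α (twistedMul α.form ((u α).symm p ⊗ₜ (u α).symm q)) +
          u α (twistedMul α.form ((u α).symm p ⊗ₜ (u α).symm r))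
      simp [TensorProduct.tmul_add]
    right_distrib := fun p q r => by
      change u α (twistedMul α.form ((u α).symm (p + q) ⊗ₜ (u α).symm r)) =
        u α (twistedMul α.form ((u α).symm p ⊗ₜ (u α).symm r)) +
          u α (twistedMul α.form ((u α).symm q ⊗ₜ (u α).symm r))
      simp [TensorProduct.add_tmul] }

theorem u_mul_u (x y : H) : u α x * u α y = u α (twistedMul α.form (x ⊗ₜ y)) := rfl

theorem u_one : u α 1 = 1 := rfl

instance : Algebra k (TwistedAlgebra α) :=
  Algebra.ofModule
    (fun r p q => by
      obtain ⟨x, rfl⟩ := (u α).surjective p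
      obtain ⟨y, rfl⟩ := (u α).surjective q
      rw [← map_smul, u_mul_u, u_mul_u, ← map_smul, ← map_smul, TensorProduct.smul_tmul'])
    (fun r p q => by
      obtain ⟨x, rfl⟩ := (u α).surjective p
      obtain ⟨y, rfl⟩ := (u α).surjective q
      rw [← map_smul, u_mul_u, u_mul_u, ← map_smul, ← map_smul, TensorProduct.tmul_smul])

/-- The linear map `u_x ↦ u_{x₁} ⊗ x₂`. -/
def coactionLinear : TwistedAlgebra α →ₗ[k] TwistedAlgebra α ⊗[k] H :=
  TensorProduct.map (u α).toLinearMap LinearMap.id ∘ₗ Coalgebra.comul ∘ₗ (u α).symm.toLinearMap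

theorem coactionLinear_u (x : H) : coactionLinear α (u α x) =
    TensorProduct.map (u α).toLinearMap LinearMap.id (Coalgebra.comul x) := by
  simp [coactionLinear]

theorem coactionLinear_one : coactionLinear α 1 = 1 := by
  rw [← u_one, coactionLinear_u, Bialgebra.comul_one]
  rfl

theorem coactionLinear_mul (p q : TwistedAlgebra α) :
    coactionLinear α (p * q) = coactionLinear α p * coactionLinear α q := by
  obtain ⟨x, rfl⟩ := (u α).surjective p
  obtain ⟨y, rfl⟩ := (u α).surjective q
  rw [u_mul_u, coactionLinear_u, coactionLinear_u, coactionLinear_u, comul_twistedMul]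
  have key : ∀ X Y : H ⊗[k] H,
      TensorProduct.map (u α).toLinearMap LinearMap.id
        (TensorProduct.map (twistedMul α.form) (LinearMap.mul' k H)
          (TensorProduct.tensorTensorTensorComm k H H H H (X ⊗ₜ Y))) =
      TensorProduct.map (u α).toLinearMap LinearMap.id X *
        TensorProduct.map (u α).toLinearMap LinearMap.id Y := by
    intro X Y
    induction X with
    | zero => simp
    | add a b ha hb => simp only [map_add, TensorProduct.add_tmul, add_mul, ha, hb]
    | tmul x1 x2 =>
    induction Y with
    | zero => simp
    | add a b ha hb => simp only [map_add, TensorProduct.tmul_add, mul_add, ha, hb]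
    | tmul y1 y2 => simp [u_mul_u]
  exact key _ _

/-- The coaction `u_x ↦ u_{x₁} ⊗ x₂`. -/
instance : ComoduleAlgebra k H (TwistedAlgebra α) where
  coaction := AlgHom.ofLinearMap (coactionLinear α) (coactionLinear_one α) (coactionLinear_mul α)
  coassoc := by
    ext p
    obtain ⟨x, rfl⟩ := (u α).surjective p
    simp only [AlgHom.comp_apply, AlgHom.ofLinearMap_apply, coactionLinear_u]
    have h1 : ∀ t : H ⊗[k] H,
        (Algebra.TensorProduct.assoc k k k (TwistedAlgebra α) H H)
          (Algebra.TensorProduct.map (AlgHom.ofLinearMap (coactionLinear α)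
            (coactionLinear_one α) (coactionLinear_mul α))
            (AlgHom.id k H) (TensorProduct.map (u α).toLinearMap LinearMap.id t)) =
        TensorProduct.map (u α).toLinearMap LinearMap.id
          (TensorProduct.assoc k H H H (Coalgebra.comul.rTensor H t)) := by
      intro t
      induction t with
      | zero => simp
      | add a b ha hb => simp only [map_add, ha, hb]
      | tmul a b =>
        simp only [TensorProduct.map_tmul, Algebra.TensorProduct.map_tmul,
          AlgHom.ofLinearMap_apply, LinearEquiv.coe_coe, coactionLinear_u,
          LinearMap.rTensor_tmul]
        generalize (Coalgebra.comul a : H ⊗[k] H) = s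
        induction s with
        | zero => simp
        | add a b ha hb => simp only [map_add, ha, hb, TensorProduct.add_tmul]
        | tmul c d => simp
    have h2 : ∀ t : H ⊗[k] H,
        (Algebra.TensorProduct.map (AlgHom.id k (TwistedAlgebra α)) (Bialgebra.comulAlgHom k H))
          (TensorProduct.map (u α).toLinearMap LinearMap.id t) =
        TensorProduct.map (u α).toLinearMap LinearMap.id (Coalgebra.comul.lTensor H t) := by
      intro t
      induction t with
      | zero => simp
      | add a b ha hb => simp only [map_add, ha, hb]
      | tmul a b => simp
    have := h1 (Coalgebra.comul x)
    rw [Coalgebra.coassoc_apply, ← h2] at this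
    exact this
  counit := by
    ext p
    obtain ⟨x, rfl⟩ := (u α).surjective p
    simp only [AlgHom.comp_apply, AlgHom.ofLinearMap_apply, coactionLinear_u]
    have h : ∀ t : H ⊗[k] H,
        (Algebra.TensorProduct.rid k k (TwistedAlgebra α))
          (Algebra.TensorProduct.map (AlgHom.id k (TwistedAlgebra α))
            (Bialgebra.counitAlgHom k H)
            (TensorProduct.map (u α).toLinearMap LinearMap.id t)) =
        u α (TensorProduct.rid k H (Coalgebra.counit.lTensor H t)) := by
      intro t
      induction t with
      | zero => simp
      | add a b ha hb => simp only [map_add, ha, hb]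
      | tmul a b => simp
    have := h (Coalgebra.comul x)
    rw [Coalgebra.lTensor_counit_comul] at this
    simpa using this

end TwistedAlgebra

/-! ### The universal comodule algebra map and the generic base algebra -/

/-- The map `μ_α : T(X_H) → S(t_H) ⊗ ᵅH`, `X_x ↦ t_{x₁} u_{x₂}`, where `S(t_H)` is the
symmetric algebra on `H` and `t_x` is `SymmetricAlgebra.ι k H x`. -/
def universalMap (α : TwoCocycle k H) :
    TensorAlgebra k H →ₐ[k] SymmetricAlgebra k H ⊗[k] TwistedAlgebra α :=
  TensorAlgebra.lift k
    (TensorProduct.map (SymmetricAlgebra.ι k H) (TwistedAlgebra.u α).toLinearMap ∘ₗ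
      Coalgebra.comul)

variable (k H) in
/-- The field of fractions `Frac S(t_H)`. -/
abbrev GenericField : Type (max u v) := FractionRing (SymmetricAlgebra k H)

/-- The inclusion `S(t_H) ⊗ ᵅH → Frac S(t_H) ⊗ ᵅH`. -/
def toGenericField (α : TwoCocycle k H) :
    SymmetricAlgebra k H ⊗[k] TwistedAlgebra α →ₐ[k] GenericField k H ⊗[k] TwistedAlgebra α :=
  Algebra.TensorProduct.map
    (IsScalarTower.toAlgHom k (SymmetricAlgebra k H) (GenericField k H))
    (AlgHom.id k (TwistedAlgebra α))

variable (k H) in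
/-- The linear map `x ↦ t_x` from `H` to `Frac S(t_H)`. -/
def genericT : H →ₗ[k] GenericField k H :=
  (IsScalarTower.toAlgHom k (SymmetricAlgebra k H) (GenericField k H)).toLinearMap ∘ₗ
    SymmetricAlgebra.ι k H

variable (k H) in
/-- The linear map `x ↦ t⁻¹_x` from `H` to `Frac S(t_H)`: the inverse of `x ↦ t_x` for the
convolution product, i.e. `t_{x₁} t⁻¹_{x₂} = t⁻¹_{x₁} t_{x₂} = ε(x)`. -/
def genericTInv : H →ₗ[k] GenericField k H :=
  (Ring.inverse (WithConv.toConv (genericT k H))).ofConv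

/-- `σ(x, y) = t_{x₁} t_{y₁} α(x₂, y₂) t⁻¹_{x₃ y₃}`, a threefold convolution product of linear
maps on the coalgebra `H ⊗ H`. -/
def genericCocycle (α : TwoCocycle k H) : H ⊗[k] H →ₗ[k] GenericField k H :=
  (WithConv.toConv (LinearMap.mul' k (GenericField k H) ∘ₗ
      TensorProduct.map (genericT k H) (genericT k H)) *
    WithConv.toConv (Algebra.linearMap k (GenericField k H) ∘ₗ α.form) *
    WithConv.toConv (genericTInv k H ∘ₗ LinearMap.mul' k H)).ofConv

/-- `σ⁻¹(x, y) = t_{x₁ y₁} α⁻¹(x₂, y₂) t⁻¹_{x₃} t⁻¹_{y₃}`. -/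
def genericCocycleInv (α : TwoCocycle k H) : H ⊗[k] H →ₗ[k] GenericField k H :=
  (WithConv.toConv (genericT k H ∘ₗ LinearMap.mul' k H) *
    WithConv.toConv (Algebra.linearMap k (GenericField k H) ∘ₗ α.inv) *
    WithConv.toConv (LinearMap.mul' k (GenericField k H) ∘ₗ
      TensorProduct.map (genericTInv k H) (genericTInv k H))).ofConv

/-- The generic base algebra `B_H^α`: the subalgebra of `Frac S(t_H)` generated by all
`σ(x, y)` and `σ⁻¹(x, y)`. -/
def genericBaseAlgebra (α : TwoCocycle k H) : Subalgebra k (GenericField k H) :=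
  Algebra.adjoin k
    (Set.range (fun p : H × H => genericCocycle α (p.1 ⊗ₜ p.2)) ∪
      Set.range (fun p : H × H => genericCocycleInv α (p.1 ⊗ₜ p.2)))

end General

/-! ### The Sweedler algebra -/

section Sweedler

universe u

/-- The Sweedler algebra `H₄`: generated by `x`, `y` with `x² = 1`, `y² = 0`, `xy + yx = 0`, with
basis `1, x, y, z = xy`. As an algebra it is the (degenerate) quaternion algebra with
`i² = 1`, `j² = 0`, `ij = k`, `ji = -k`, where `x = i`, `y = j`, `z = k`. -/
abbrev SweedlerAlgebra (k : Type u) [Field k] : Type u := QuaternionAlgebra k (1 : k) 0 0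

namespace SweedlerAlgebra

variable (k : Type u) [Field k]

def x : SweedlerAlgebra k := ⟨0, 1, 0, 0⟩

def y : SweedlerAlgebra k := ⟨0, 0, 1, 0⟩

def z : SweedlerAlgebra k := ⟨0, 0, 0, 1⟩

theorem x_mul_x : x k * x k = 1 := by ext <;> simp [x]

theorem y_mul_y : y k * y k = 0 := by ext <;> simp [y]

theorem x_mul_y : x k * y k = z k := by ext <;> simp [x, y, z]

theorem y_mul_x : y k * x k = - z k := by ext <;> simp [x, y, z]

theorem x_mul_z : x k * z k = y k := by ext <;> simp [x, y, z]

theorem z_mul_x : z k * x k = - y k := by ext <;> simp [x, y, z]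

theorem y_mul_z : y k * z k = 0 := by ext <;> simp [y, z]

theorem z_mul_y : z k * y k = 0 := by ext <;> simp [y, z]

theorem z_mul_z : z k * z k = 0 := by ext <;> simp [z]

/-- The coproduct, the algebra map with `Δ(x) = x ⊗ x` and `Δ(y) = 1 ⊗ y + y ⊗ x`. -/
def comulHom : SweedlerAlgebra k →ₐ[k] SweedlerAlgebra k ⊗[k] SweedlerAlgebra k :=
  QuaternionAlgebra.Basis.liftHom
    { i := x k ⊗ₜ x k
      j := 1 ⊗ₜ y k + y k ⊗ₜ x k
      k := x k ⊗ₜ z k + z k ⊗ₜ 1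
      i_mul_i := by simp [x_mul_x, Algebra.TensorProduct.one_def]
      j_mul_j := by
        simp [mul_add, add_mul, y_mul_y, x_mul_y, y_mul_x, TensorProduct.tmul_neg]
      i_mul_j := by simp [mul_add, x_mul_x, x_mul_y]
      j_mul_i := by
        simp [add_mul, x_mul_x, y_mul_x, TensorProduct.tmul_neg, TensorProduct.neg_tmul]
        abel }

/-- The counit, the algebra map with `ε(x) = 1` and `ε(y) = 0`. -/
def counitHom : SweedlerAlgebra k →ₐ[k] k :=
  QuaternionAlgebra.Basis.liftHom
    { i := 1, j := 0, k := 0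
      i_mul_i := by simp
      j_mul_j := by simp
      i_mul_j := by simp
      j_mul_i := by simp }

theorem comulHom_x : comulHom k (x k) = x k ⊗ₜ x k := by
  simp [comulHom, QuaternionAlgebra.Basis.lift, x]

theorem comulHom_y : comulHom k (y k) = 1 ⊗ₜ y k + y k ⊗ₜ x k := by
  simp [comulHom, QuaternionAlgebra.Basis.lift, y]

theorem comulHom_z : comulHom k (z k) = x k ⊗ₜ z k + z k ⊗ₜ 1 := by
  simp [comulHom, QuaternionAlgebra.Basis.lift, z]

theorem counitHom_x : counitHom k (x k) = 1 := by
  simp [counitHom, QuaternionAlgebra.Basis.lift, x]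

theorem counitHom_y : counitHom k (y k) = 0 := by
  simp [counitHom, QuaternionAlgebra.Basis.lift, y]

theorem counitHom_z : counitHom k (z k) = 0 := by
  simp [counitHom, QuaternionAlgebra.Basis.lift, z]

instance : Bialgebra k (SweedlerAlgebra k) :=
  Bialgebra.ofAlgHom (comulHom k) (counitHom k)
    (by
      apply QuaternionAlgebra.hom_ext
      · change _ = (Algebra.TensorProduct.map _ _) (comulHom k (x k))
        change (Algebra.TensorProduct.assoc k k k _ _ _)
          ((Algebra.TensorProduct.map _ _) (comulHom k (x k))) = _
        simp [comulHom_x]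
      · change _ = (Algebra.TensorProduct.map _ _) (comulHom k (y k))
        change (Algebra.TensorProduct.assoc k k k _ _ _)
          ((Algebra.TensorProduct.map _ _) (comulHom k (y k))) = _
        simp [comulHom_x, comulHom_y, TensorProduct.tmul_add, TensorProduct.add_tmul,
          Algebra.TensorProduct.one_def, add_assoc])
    (by
      apply QuaternionAlgebra.hom_ext
      · change (Algebra.TensorProduct.map _ _) (comulHom k (x k)) = 1 ⊗ₜ x k
        simp [comulHom_x, counitHom_x]
      · change (Algebra.TensorProduct.map _ _) (comulHom k (y k)) = 1 ⊗ₜ y k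
        simp [comulHom_y, counitHom_y])
    (by
      apply QuaternionAlgebra.hom_ext
      · change (Algebra.TensorProduct.map _ _) (comulHom k (x k)) = x k ⊗ₜ 1
        simp [comulHom_x, counitHom_x]
      · change (Algebra.TensorProduct.map _ _) (comulHom k (y k)) = y k ⊗ₜ 1
        simp [comulHom_y, counitHom_x, counitHom_y])

theorem comul_x : Coalgebra.comul (R := k) (x k) = x k ⊗ₜ x k := comulHom_x k

theorem comul_y : Coalgebra.comul (R := k) (y k) = 1 ⊗ₜ y k + y k ⊗ₜ x k := comulHom_y k

theorem comul_z : Coalgebra.comul (R := k) (z k) = x k ⊗ₜ z k + z k ⊗ₜ 1 := comulHom_z k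

theorem counit_x : Coalgebra.counit (R := k) (x k) = 1 := counitHom_x k

theorem counit_y : Coalgebra.counit (R := k) (y k) = 0 := counitHom_y k

theorem counit_z : Coalgebra.counit (R := k) (z k) = 0 := counitHom_z k

/-- Linear maps on `H₄` are determined by their values on the basis `1, x, y, z`. -/
theorem linearMap_ext {M : Type*} [AddCommMonoid M] [Module k M]
    {f g : SweedlerAlgebra k →ₗ[k] M} (h1 : f 1 = g 1) (hx : f (x k) = g (x k))
    (hy : f (y k) = g (y k)) (hz : f (z k) = g (z k)) : f = g := by
  ext w
  have hw : w = w.re • (1 : SweedlerAlgebra k) + w.imI • x k + w.imJ • y k + w.imK • z k := by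
    ext <;> simp [x, y, z]
  rw [hw]
  simp only [map_add, map_smul, h1, hx, hy, hz]

/-- The antipode: `S(1) = 1`, `S(x) = x`, `S(y) = z`, `S(z) = -y`. -/
def antipodeMap : SweedlerAlgebra k →ₗ[k] SweedlerAlgebra k where
  toFun w := ⟨w.re, w.imI, -w.imK, w.imJ⟩
  map_add' v w := by ext <;> simp [add_comm]
  map_smul' r w := by ext <;> simp

theorem antipodeMap_one : antipodeMap k 1 = 1 := by ext <;> simp [antipodeMap]

theorem antipodeMap_x : antipodeMap k (x k) = x k := by ext <;> simp [antipodeMap, x]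

theorem antipodeMap_y : antipodeMap k (y k) = z k := by ext <;> simp [antipodeMap, y, z]

theorem antipodeMap_z : antipodeMap k (z k) = - y k := by ext <;> simp [antipodeMap, y, z]

instance : HopfAlgebra k (SweedlerAlgebra k) where
  antipode := antipodeMap k
  mul_antipode_rTensor_comul := by
    apply linearMap_ext <;>
    simp [comul_x, comul_y, comul_z, counit_x, counit_y, counit_z, antipodeMap_one,
      antipodeMap_x, antipodeMap_y, antipodeMap_z, x_mul_x, x_mul_z, z_mul_x,
      Algebra.TensorProduct.one_def]
  mul_antipode_lTensor_comul := by
    apply linearMap_ext <;>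
    simp [comul_x, comul_y, comul_z, counit_x, counit_y, counit_z, antipodeMap_one,
      antipodeMap_x, antipodeMap_y, antipodeMap_z, x_mul_x, x_mul_y, y_mul_x,
      Algebra.TensorProduct.one_def]

end SweedlerAlgebra

/-- The convolution inverse of `x ↦ t_x` exists for the Sweedler algebra, so that the map
`x ↦ t⁻¹_x` has its defining property. -/
theorem isUnit_genericT_sweedler (k : Type u) [Field k] :
    IsUnit (WithConv.toConv (genericT k (SweedlerAlgebra k))) := by
  set t := genericT k (SweedlerAlgebra k) with ht
  have hinj : ∀ w : SweedlerAlgebra k, w ≠ 0 → t w ≠ 0 := by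
    intro w hw h
    apply hw
    have h' : algebraMap (SymmetricAlgebra k (SweedlerAlgebra k))
        (GenericField k (SweedlerAlgebra k)) (SymmetricAlgebra.ι k _ w) = 0 := h
    rw [map_eq_zero_iff _ (IsFractionRing.injective (SymmetricAlgebra k (SweedlerAlgebra k))
        (GenericField k (SweedlerAlgebra k)))] at h'
    refine (Module.forall_dual_apply_eq_zero_iff k w).1 fun f => ?_
    rw [← SymmetricAlgebra.lift_ι_apply f w, h', map_zero]
  have h1 : t 1 ≠ 0 := hinj 1 one_ne_zero
  have hx : t (SweedlerAlgebra.x k) ≠ 0 := hinj _ (by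
    intro h
    have := congrArg QuaternionAlgebra.imI h
    simp [SweedlerAlgebra.x] at this)
  let s : SweedlerAlgebra k →ₗ[k] GenericField k (SweedlerAlgebra k) :=
    { toFun := fun w => w.re • (t 1)⁻¹ + w.imI • (t (SweedlerAlgebra.x k))⁻¹ -
        w.imJ • (t (SweedlerAlgebra.y k) / (t 1 * t (SweedlerAlgebra.x k))) -
        w.imK • (t (SweedlerAlgebra.z k) / (t 1 * t (SweedlerAlgebra.x k)))
      map_add' := fun v w => by simp only [QuaternionAlgebra.re_add, QuaternionAlgebra.imI_add,
        QuaternionAlgebra.imJ_add, QuaternionAlgebra.imK_add, add_smul]; ring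
      map_smul' := fun r w => by
        simp [smul_sub, smul_add, mul_smul] }
  have s1 : s 1 = (t 1)⁻¹ := by simp [s]
  have sx : s (SweedlerAlgebra.x k) = (t (SweedlerAlgebra.x k))⁻¹ := by
    simp [s, SweedlerAlgebra.x]
  have sy : s (SweedlerAlgebra.y k) =
      -(t (SweedlerAlgebra.y k) / (t 1 * t (SweedlerAlgebra.x k))) := by
    simp [s, SweedlerAlgebra.y]
  have sz : s (SweedlerAlgebra.z k) =
      -(t (SweedlerAlgebra.z k) / (t 1 * t (SweedlerAlgebra.x k))) := by
    simp [s, SweedlerAlgebra.z]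
  refine ⟨⟨WithConv.toConv t, WithConv.toConv s, ?_, ?_⟩, rfl⟩ <;>
  · apply WithConv.ofConv_injective
    apply SweedlerAlgebra.linearMap_ext <;>
    simp [LinearMap.convMul_def, LinearMap.convOne_def, SweedlerAlgebra.comul_x,
      SweedlerAlgebra.comul_y, SweedlerAlgebra.comul_z, SweedlerAlgebra.counit_x,
      SweedlerAlgebra.counit_y, SweedlerAlgebra.counit_z, Algebra.TensorProduct.one_def,
      s1, sx, sy, sz, h1, hx] <;>
    field_simp <;> ring

/-! ### The comodule algebras `A_{a,b,c}` -/

/-- The generators of `A_{a,b,c}`. -/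
inductive TwistGen : Type
  | ux
  | uy

/-- The defining relations `u_x² = a`, `u_x u_y + u_y u_x = b`, `u_y² = c` of `A_{a,b,c}`. -/
inductive SweedlerTwistRel {k : Type u} [Field k] (a b c : k) :
    FreeAlgebra k TwistGen → FreeAlgebra k TwistGen → Prop
  | xx : SweedlerTwistRel a b c
      (FreeAlgebra.ι k TwistGen.ux * FreeAlgebra.ι k TwistGen.ux) (algebraMap k _ a)
  | xy : SweedlerTwistRel a b c
      (FreeAlgebra.ι k TwistGen.ux * FreeAlgebra.ι k TwistGen.uy +
        FreeAlgebra.ι k TwistGen.uy * FreeAlgebra.ι k TwistGen.ux) (algebraMap k _ b)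
  | yy : SweedlerTwistRel a b c
      (FreeAlgebra.ι k TwistGen.uy * FreeAlgebra.ι k TwistGen.uy) (algebraMap k _ c)

/-- The algebra `A_{a,b,c}` given by the generators `u_x`, `u_y` and the relations
`u_x² = a`, `u_x u_y + u_y u_x = b`, `u_y² = c`. -/
abbrev SweedlerTwist {k : Type u} [Field k] (a b c : k) : Type u :=
  RingQuot (SweedlerTwistRel a b c)

namespace SweedlerTwist

variable {k : Type u} [Field k] (a b c : k)

def ux : SweedlerTwist a b c :=
  RingQuot.mkAlgHom k (SweedlerTwistRel a b c) (FreeAlgebra.ι k TwistGen.ux)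

def uy : SweedlerTwist a b c :=
  RingQuot.mkAlgHom k (SweedlerTwistRel a b c) (FreeAlgebra.ι k TwistGen.uy)

theorem ux_mul_ux : ux a b c * ux a b c = algebraMap k _ a := by
  rw [ux, ← map_mul, RingQuot.mkAlgHom_rel k SweedlerTwistRel.xx, AlgHom.commutes]

theorem ux_mul_uy_add : ux a b c * uy a b c + uy a b c * ux a b c = algebraMap k _ b := by
  rw [ux, uy, ← map_mul, ← map_mul, ← map_add, RingQuot.mkAlgHom_rel k SweedlerTwistRel.xy,
    AlgHom.commutes]

theorem uy_mul_uy : uy a b c * uy a b c = algebraMap k _ c := by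
  rw [uy, ← map_mul, RingQuot.mkAlgHom_rel k SweedlerTwistRel.yy, AlgHom.commutes]

/-- Values of the coaction on generators: `u_x ↦ u_x ⊗ x`, `u_y ↦ 1 ⊗ y + u_y ⊗ x`. -/
def coactionGen : TwistGen → SweedlerTwist a b c ⊗[k] SweedlerAlgebra k
  | TwistGen.ux => ux a b c ⊗ₜ SweedlerAlgebra.x k
  | TwistGen.uy => 1 ⊗ₜ SweedlerAlgebra.y k + uy a b c ⊗ₜ SweedlerAlgebra.x k

/-- The coaction of `A_{a,b,c}` as an algebra map. -/
def coactionHom : SweedlerTwist a b c →ₐ[k] SweedlerTwist a b c ⊗[k] SweedlerAlgebra k :=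
  RingQuot.liftAlgHom k ⟨FreeAlgebra.lift k (coactionGen a b c), by
    intro p q h
    have hz : ∀ r : k, algebraMap k (SweedlerTwist a b c ⊗[k] SweedlerAlgebra k) r =
        (algebraMap k (SweedlerTwist a b c) r) ⊗ₜ 1 := fun r =>
      Algebra.TensorProduct.algebraMap_apply r
    cases h with
    | xx =>
      simp [coactionGen, ux_mul_ux, SweedlerAlgebra.x_mul_x, hz]
    | xy =>
      rw [AlgHom.commutes, hz, ← ux_mul_uy_add]
      simp [coactionGen, SweedlerAlgebra.x_mul_x, SweedlerAlgebra.x_mul_y,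
        SweedlerAlgebra.y_mul_x, mul_add, add_mul, TensorProduct.add_tmul,
        TensorProduct.tmul_neg]
      abel
    | yy =>
      simp [coactionGen, uy_mul_uy, SweedlerAlgebra.x_mul_x, SweedlerAlgebra.x_mul_y,
        SweedlerAlgebra.y_mul_x, SweedlerAlgebra.y_mul_y, mul_add, add_mul,
        TensorProduct.tmul_neg, hz]
      abel⟩

theorem coactionHom_ux : coactionHom a b c (ux a b c) = ux a b c ⊗ₜ SweedlerAlgebra.x k := by
  rw [coactionHom, ux, RingQuot.liftAlgHom_mkAlgHom_apply, FreeAlgebra.lift_ι_apply]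
  rfl

theorem coactionHom_uy : coactionHom a b c (uy a b c) =
    1 ⊗ₜ SweedlerAlgebra.y k + uy a b c ⊗ₜ SweedlerAlgebra.x k := by
  rw [coactionHom, uy, RingQuot.liftAlgHom_mkAlgHom_apply, FreeAlgebra.lift_ι_apply]
  rfl

theorem algHom_ext {B : Type*} [Ring B] [Algebra k B] {f g : SweedlerTwist a b c →ₐ[k] B}
    (hx : f (ux a b c) = g (ux a b c)) (hy : f (uy a b c) = g (uy a b c)) : f = g := by
  apply RingQuot.ringQuot_ext'
  apply FreeAlgebra.hom_ext
  funext i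
  cases i
  · exact hx
  · exact hy

instance : ComoduleAlgebra k (SweedlerAlgebra k) (SweedlerTwist a b c) where
  coaction := coactionHom a b c
  coassoc := by
    apply algHom_ext
    · simp [coactionHom_ux, SweedlerAlgebra.comul_x]
    · simp [coactionHom_uy, SweedlerAlgebra.comul_x, SweedlerAlgebra.comul_y,
        TensorProduct.add_tmul, TensorProduct.tmul_add, Algebra.TensorProduct.one_def, add_assoc]
  counit := by
    apply algHom_ext
    · simp [coactionHom_ux, SweedlerAlgebra.counit_x]
    · simp [coactionHom_uy, SweedlerAlgebra.counit_x, SweedlerAlgebra.counit_y]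

end SweedlerTwist

/-! ### The algebra `k[E, E⁻¹, R, R⁻¹, S, T, U] / (D_{a,b,c})` -/

/-- The indeterminates `E, R, S, T, U`. -/
inductive SweedlerVar : Type
  | E
  | R
  | S
  | T
  | U

/-- The algebra `k[E, E⁻¹, R, R⁻¹, S, T, U]`. -/
abbrev SweedlerLaurent (k : Type u) [Field k] : Type u :=
  Localization (Submonoid.closure
    {(MvPolynomial.X SweedlerVar.E : MvPolynomial SweedlerVar k), MvPolynomial.X SweedlerVar.R})

/-- An indeterminate as an element of `k[E, E⁻¹, R, R⁻¹, S, T, U]`. -/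
def SweedlerLaurent.var (k : Type u) [Field k] (i : SweedlerVar) : SweedlerLaurent k :=
  algebraMap (MvPolynomial SweedlerVar k) (SweedlerLaurent k) (MvPolynomial.X i)

open SweedlerLaurent in
/-- `D_{a,b,c} = T² - 4RS - ((b² - 4ac)/a) E²R`. -/
def sweedlerD {k : Type u} [Field k] (a b c : k) : SweedlerLaurent k :=
  var k .T ^ 2 - 4 * var k .R * var k .S - ((b ^ 2 - 4 * a * c) / a) • (var k .E ^ 2 * var k .R)

/-- The algebra `k[E, E⁻¹, R, R⁻¹, S, T, U] / (D_{a,b,c})`. -/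
abbrev SweedlerCenterModel {k : Type u} [Field k] (a b c : k) : Type u :=
  SweedlerLaurent k ⧸ Ideal.span {sweedlerD a b c}

/-- The class of an indeterminate in `k[E, E⁻¹, R, R⁻¹, S, T, U] / (D_{a,b,c})`. -/
def SweedlerCenterModel.var {k : Type u} [Field k] (a b c : k) (i : SweedlerVar) :
    SweedlerCenterModel a b c :=
  Ideal.Quotient.mk _ (SweedlerLaurent.var k i)

/-- The elements `E = X_1`, `R = X²`, `S = Y²`, `T = XY + YX`, `U = X(XZ + ZX)` of `T(X_H)`, where
`X = X_x`, `Y = X_y`, `Z = X_z`. -/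
def sweedlerElem (k : Type u) [Field k] : SweedlerVar → TensorAlgebra k (SweedlerAlgebra k) :=
  let X := TensorAlgebra.ι k (SweedlerAlgebra.x k)
  let Y := TensorAlgebra.ι k (SweedlerAlgebra.y k)
  let Z := TensorAlgebra.ι k (SweedlerAlgebra.z k)
  fun
  | .E => TensorAlgebra.ι k (1 : SweedlerAlgebra k)
  | .R => X ^ 2
  | .S => Y ^ 2
  | .T => X * Y + Y * X
  | .U => X * (X * Z + Z * X)

/-- The image of `E`, `R`, `S`, `T` or `U` in `U_H^α`. -/
def sweedlerClass {k : Type u} [Field k] (α : TwoCocycle k (SweedlerAlgebra k))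
    (i : SweedlerVar) : UniversalComoduleAlgebra k (SweedlerAlgebra k) (TwistedAlgebra α) :=
  universalMk k (SweedlerAlgebra k) (TwistedAlgebra α) (sweedlerElem k i)

/-- The center `Z_H^α` of the universal comodule algebra `U_H^α` of `ᵅH₄`. -/
abbrev sweedlerCenter {k : Type u} [Field k] (α : TwoCocycle k (SweedlerAlgebra k)) :
    Subalgebra k (UniversalComoduleAlgebra k (SweedlerAlgebra k) (TwistedAlgebra α)) :=
  universalCenter k (SweedlerAlgebra k) (TwistedAlgebra α)

/-- The localization `Z_H^α[E⁻¹, R⁻¹]`, for elements `E`, `R` of `Z_H^α`. -/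
abbrev SweedlerCenterLocalization {k : Type u} [Field k]
    (α : TwoCocycle k (SweedlerAlgebra k)) (E R : sweedlerCenter α) : Type u :=
  Localization (Submonoid.closure {E, R})

end Sweedler

end

/-! Since 2 is invertible, the square can be completed in `ᵅH`. With `a' = u_x²`, `b' = u_x u_y +
u_y u_x` and `c' = u_y²`, the elements `i = u_x` and `j = u_y - (b'/2a') u_x` anticommute, and `i² =
a'`, `j² = d` with `d = c' - b'²/4a'`. So `R ⊗ ᵅH` is a (possibly degenerate) quaternion algebra
over every commutative `k`-algebra `R` (`quatBasis`).

As a comodule `ᵅH` is cofree, so the comodule algebra maps `T(X_H) → ᵅH` are the maps `X_h ↦ τ(h₁)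
u_{h₂}` for linear forms `τ` on `H`. Over an infinite field their common kernel is the kernel of the
generic point `τ = t` (`mem_identityIdeal_iff_genericHom`). Hence `U_H^α` embeds in the quaternion
algebra over `K = Frac S(t_H)`, with `X_1 = t_1`, `X_x = t_x i`, `X_y = v i + t_1 j` and `X_z = q +
t_x k`, where `v` and `q` are `t_y` and `t_z` up to shifts. Only scalars commute with `X_x` and
`X_y`, so the center embeds in `K`.

All three algebras of the theorem are then identified with one subalgebra of `K`, namely `B =
k[t_1^{±1}, t_x^{±2}, t_x v, q]` (`baseSubalgebra`).

The localized center: every element of `U_H^α` has its `1`- and `j`-coordinates in `B` and its `i`-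
and `k`-coordinates in `t_x B`, so the center lies in `B`. Conversely `E = t_1`, `R = a' t_x²`, `T =
2a' t_x v` and `U = 2a' t_x² q` generate `B` once `E` and `R` are inverted
(`range_centerLocalizationHom`).

The model: as `S = a' v² + d t_1²`, the relation `T² - 4RS = -4d E² R` holds, and `-4d = (b² -
4ac)/a` because this number is an invariant of the comodule algebra (`discriminant_eq`). The
relation eliminates `S`, and `E, R, T, U` are algebraically independent, so there is no further
relation (`modelHom_injective`).

The generic base algebra: `σ(g, h)` is the image of `X_g X_h` under `c ⊗ u_h ↦ c t⁻¹_h`, which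
brings it into `B`. The values of `σ⁻¹` follow by solving the convolution identity, and simple
values of `σ` recover `E, R, S, T, U` (`genericBaseAlgebra_eq`). -/

noncomputable section

namespace SweedlerGeneric

universe u v w

open SweedlerAlgebra TwistedAlgebra

variable {k : Type u} [Field k]

/-! ### The structure of `ᵅH₄` -/

section Structure

variable (α : TwoCocycle k (SweedlerAlgebra k))

/-- The scalar `u_x²`. -/
def sqX : k := α.form (x k ⊗ₜ x k)

/-- The scalar `u_x u_y + u_y u_x`. -/
def antiXY : k := α.form (x k ⊗ₜ y k) + α.form (y k ⊗ₜ x k)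

/-- The scalar `u_y²`. -/
def sqY : k := α.form (y k ⊗ₜ y k)

theorem u_x_mul_u_x : u α (x k) * u α (x k) = sqX α • 1 := by
  rw [u_mul_u, ← u_one, ← map_smul]
  refine congrArg (u α) ?_
  simp [twistedMul, TensorProduct.comul_tmul, comul_x, x_mul_x, sqX]

/-- `Δ(x ⊗ y)` has two terms. One contributes `α(x, 1) u_z`, with coefficient 1 by normalization,
and the other `α(x, y) u_{x²}`. -/
theorem u_x_mul_u_y :
    u α (x k) * u α (y k) = u α (z k) + α.form (x k ⊗ₜ y k) • 1 := by
  rw [u_mul_u, ← u_one, ← map_smul, ← map_add]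
  refine congrArg (u α) ?_
  simp [twistedMul, TensorProduct.comul_tmul, comul_x, comul_y, x_mul_x, x_mul_y,
    TensorProduct.tmul_add, α.form_one_right, counit_x]

theorem u_y_mul_u_x :
    u α (y k) * u α (x k) = -u α (z k) + α.form (y k ⊗ₜ x k) • 1 := by
  rw [u_mul_u, ← u_one, ← map_smul, ← map_neg, ← map_add]
  refine congrArg (u α) ?_
  simp [twistedMul, TensorProduct.comul_tmul, comul_x, comul_y, x_mul_x, y_mul_x,
    TensorProduct.add_tmul, α.form_one_left, counit_x]

/-- Of the four terms of `Δ(y ⊗ y)`, one dies by `y² = 0` and two by normalization, since `ε(y) =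
0`. -/
theorem u_y_mul_u_y : u α (y k) * u α (y k) = sqY α • 1 := by
  rw [u_mul_u, ← u_one, ← map_smul]
  refine congrArg (u α) ?_
  simp [twistedMul, TensorProduct.comul_tmul, comul_y, x_mul_x, x_mul_y, y_mul_x, y_mul_y,
    TensorProduct.add_tmul, TensorProduct.tmul_add, α.form_one_left, α.form_one_right, counit_y,
    sqY]

theorem u_x_mul_u_y_add :
    u α (x k) * u α (y k) + u α (y k) * u α (x k) = antiXY α • 1 := by
  rw [u_x_mul_u_y, u_y_mul_u_x, antiXY, add_smul]
  abel

/-- As `x` is grouplike, the identity `α * α⁻¹ = ε` at `x ⊗ x` is a product of two scalars equal to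
1. -/
theorem sqX_ne_zero : sqX α ≠ 0 := by
  intro h
  have h1 := congrArg (fun f : WithConv (SweedlerAlgebra k ⊗[k] SweedlerAlgebra k →ₗ[k] k) =>
    f.ofConv (x k ⊗ₜ x k)) α.form_mul_inv
  simp only [LinearMap.convMul_def, LinearMap.convOne_def] at h1
  simp [TensorProduct.comul_tmul, comul_x, counit_x] at h1
  rw [sqX] at h
  simp [h] at h1

/-- The coefficient `(u_x u_y + u_y u_x) / (2 u_x²)`. -/
def shiftY : k := antiXY α / (2 * sqX α)

/-- The coefficient `(α(y, x) - α(x, y)) / 2`. -/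
def shiftZ : k := (α.form (y k ⊗ₜ x k) - α.form (x k ⊗ₜ y k)) / 2

/-- The square of `u_y - shiftY • u_x`. -/
def sqJ : k := sqY α - antiXY α ^ 2 / (4 * sqX α)

/-- The quaternion algebra over `R` isomorphic to `R ⊗ ᵅH₄`. -/
abbrev Quat (R : Type v) [CommRing R] [Algebra k R] : Type v :=
  QuaternionAlgebra R (algebraMap k R (sqX α)) 0 (algebraMap k R (sqJ α))

end Structure

/-! ### Quaternion coordinates and points. -/

section Maps

/-- This and the next identity serve twice: to complete the square with `s = shiftY`, and with `s =
-n` to compare presentations in `discriminant_eq`. -/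
theorem sub_smul_mul_self {A : Type*} [Ring A] [Algebra k A] (s : k) (p q : A) :
    (q - s • p) * (q - s • p) = q * q - s • (p * q + q * p) + (s ^ 2) • (p * p) := by
  simp only [mul_sub, sub_mul, smul_mul_assoc, mul_smul_comm, smul_add, smul_sub, pow_two, mul_smul]
  abel

theorem sub_smul_mul_add {A : Type*} [Ring A] [Algebra k A] (s : k) (p q : A) :
    (q - s • p) * p + p * (q - s • p) = (p * q + q * p) - (2 * s) • (p * p) := by
  simp only [mul_sub, sub_mul, smul_mul_assoc, mul_smul_comm, two_mul, add_smul]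
  abel

variable (α : TwoCocycle k (SweedlerAlgebra k)) {R : Type v} [CommRing R] [Algebra k R]
  {B : Type w} [Ring B] [Algebra k B] [Algebra R B] [IsScalarTower k R B]

/-- The quaternion basis `u_x`, `u_y - shiftY • u_x` in an algebra receiving a map from `ᵅH₄`. -/
def quatBasis (h2 : (2 : k) ≠ 0) (f : TwistedAlgebra α →ₐ[k] B) :
    QuaternionAlgebra.Basis B (algebraMap k R (sqX α)) 0 (algebraMap k R (sqJ α)) where
  i := f (u α (x k))
  j := f (u α (y k) - shiftY α • u α (x k))
  k := f (u α (x k) * (u α (y k) - shiftY α • u α (x k)))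
  i_mul_i := by
    rw [← map_mul, u_x_mul_u_x, map_smul, map_one, algebraMap_smul, zero_smul, add_zero]
  j_mul_j := by
    rw [algebraMap_smul, ← map_mul, ← map_one f, ← map_smul f]
    refine congrArg f ?_
    have ha := sqX_ne_zero α
    have e := sub_smul_mul_self (shiftY α) (u α (x k)) (u α (y k))
    rw [e, u_x_mul_u_y_add, u_x_mul_u_x, u_y_mul_u_y, smul_smul, smul_smul, ← sub_smul,
      ← add_smul]
    refine congrArg (· • (1 : TwistedAlgebra α)) ?_
    -- With 4 in this form, `h2` suffices to clear denominators.
    have h4 : (4 : k) = 2 * 2 := by norm_num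
    rw [sqJ, shiftY, h4]
    field_simp
    ring
  i_mul_j := by rw [map_mul]
  j_mul_i := by
    rw [← map_mul, zero_smul, zero_sub, ← map_neg]
    refine congrArg f ?_
    have ha := sqX_ne_zero α
    have e := sub_smul_mul_add (shiftY α) (u α (x k)) (u α (y k))
    rw [u_x_mul_u_y_add, u_x_mul_u_x, smul_smul, ← sub_smul] at e
    -- The shift is chosen exactly so that the anticommutator with `u_x` vanishes.
    have e0 : antiXY α - 2 * shiftY α * sqX α = 0 := by
      rw [shiftY]
      field_simp
      ring
    rw [e0, zero_smul] at e
    exact eq_neg_of_add_eq_zero_left e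

/-- The map from the quaternion algebra induced by a map from `ᵅH₄`. -/
def quatHom (h2 : (2 : k) ≠ 0) (f : TwistedAlgebra α →ₐ[k] B) : Quat α R →ₐ[R] B :=
  (quatBasis α h2 f).liftHom

theorem quatHom_apply (h2 : (2 : k) ≠ 0) (f : TwistedAlgebra α →ₐ[k] B) (q : Quat α R) :
    quatHom α h2 f q = (q.re - shiftZ α • q.imK) • f (u α 1) +
      (q.imI - shiftY α • q.imJ) • f (u α (x k)) + q.imJ • f (u α (y k)) +
      q.imK • f (u α (z k)) := by
  have ha := sqX_ne_zero α
  -- The third basis vector is `u_z` only up to a scalar: `α(x, y) - shiftY · u_x²` equals `(α(x, y)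
  -- - α(y, x))/2`.
  have e : u α (x k) * (u α (y k) - shiftY α • u α (x k)) = u α (z k) - shiftZ α • 1 := by
    rw [mul_sub, mul_smul_comm, u_x_mul_u_y, u_x_mul_u_x, smul_smul, add_sub_assoc, ← sub_smul,
      sub_eq_add_neg (u α (z k)), ← neg_smul]
    congr 2
    rw [shiftY, shiftZ, antiXY]
    field_simp
    ring
  have hs : ∀ (r : k) (s : R) (b : B), r • s • b = s • r • b := fun r s b => smul_comm r s b
  simp only [quatHom, QuaternionAlgebra.Basis.liftHom_apply, QuaternionAlgebra.Basis.lift,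
    quatBasis, e, u_one, map_sub, map_smul, map_one, Algebra.algebraMap_eq_smul_one, smul_sub,
    sub_smul, smul_assoc, hs]
  abel

/-- The generic element map `h ↦ τ(h₁) u_{h₂}` in quaternion coordinates. -/
def pointLinear (τ : SweedlerAlgebra k →ₗ[k] R) : SweedlerAlgebra k →ₗ[k] Quat α R where
  toFun h := ⟨h.re • τ 1 + h.imK • (shiftZ α • τ (x k) + τ (z k)),
    h.imI • τ (x k) + h.imJ • (shiftY α • τ 1 + τ (y k)), h.imJ • τ 1, h.imK • τ (x k)⟩
  map_add' g h := by
    ext <;> simp only [QuaternionAlgebra.re_add, QuaternionAlgebra.imI_add,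
      QuaternionAlgebra.imJ_add, QuaternionAlgebra.imK_add, add_smul] <;> abel
  map_smul' r h := by
    ext <;> simp only [QuaternionAlgebra.re_smul, QuaternionAlgebra.imI_smul,
      QuaternionAlgebra.imJ_smul, QuaternionAlgebra.imK_smul, smul_eq_mul, mul_smul, smul_add,
      RingHom.id_apply]

theorem pointLinear_one (τ : SweedlerAlgebra k →ₗ[k] R) :
    pointLinear α τ 1 = ⟨τ 1, 0, 0, 0⟩ := by
  ext <;> simp [pointLinear]

theorem pointLinear_x (τ : SweedlerAlgebra k →ₗ[k] R) :
    pointLinear α τ (x k) = ⟨0, τ (x k), 0, 0⟩ := by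
  ext <;> simp [pointLinear, x]

theorem pointLinear_y (τ : SweedlerAlgebra k →ₗ[k] R) :
    pointLinear α τ (y k) = ⟨0, shiftY α • τ 1 + τ (y k), τ 1, 0⟩ := by
  ext <;> simp [pointLinear, y]

theorem pointLinear_z (τ : SweedlerAlgebra k →ₗ[k] R) :
    pointLinear α τ (z k) = ⟨shiftZ α • τ (x k) + τ (z k), 0, 0, τ (x k)⟩ := by
  ext <;> simp [pointLinear, z]

/-- The algebra map `X_h ↦ τ(h₁) u_{h₂}` in quaternion coordinates. -/
def pointHom (τ : SweedlerAlgebra k →ₗ[k] R) :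
    TensorAlgebra k (SweedlerAlgebra k) →ₐ[k] Quat α R :=
  TensorAlgebra.lift k (pointLinear α τ)

theorem pointHom_ι (τ : SweedlerAlgebra k →ₗ[k] R) (h : SweedlerAlgebra k) :
    pointHom α τ (TensorAlgebra.ι k h) = pointLinear α τ h := by
  simp [pointHom]

/-- The hypotheses on `L` spell out `L h = τ(h₁) f(u_{h₂})` on the basis. The shifts built into
`pointLinear` cancel those of `quatHom_apply`. -/
theorem quatHom_pointLinear (h2 : (2 : k) ≠ 0) (f : TwistedAlgebra α →ₐ[k] B)
    (τ : SweedlerAlgebra k →ₗ[k] R) (L : SweedlerAlgebra k →ₗ[k] B)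
    (h1 : L 1 = τ 1 • f (u α 1)) (hx : L (x k) = τ (x k) • f (u α (x k)))
    (hy : L (y k) = τ 1 • f (u α (y k)) + τ (y k) • f (u α (x k)))
    (hz : L (z k) = τ (x k) • f (u α (z k)) + τ (z k) • f (u α 1)) (h : SweedlerAlgebra k) :
    quatHom α h2 f (pointLinear α τ h) = L h := by
  suffices ((quatHom α h2 f).toLinearMap.restrictScalars k) ∘ₗ pointLinear α τ = L from
    LinearMap.congr_fun this h
  apply linearMap_ext <;>
  simp only [LinearMap.comp_apply, LinearMap.restrictScalars_apply, AlgHom.toLinearMap_apply,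
    pointLinear_one, pointLinear_x, pointLinear_y, pointLinear_z, quatHom_apply, h1, hx, hy, hz,
    smul_zero, sub_zero, zero_smul, add_zero, zero_add]
  · rw [add_sub_cancel_left]
    abel
  · rw [add_sub_cancel_left]
    abel

/-- `X_h ↦ τ(h₁) u_{h₂}` factors through the quaternion algebra. -/
theorem quatHom_pointHom (h2 : (2 : k) ≠ 0) (f : TwistedAlgebra α →ₐ[k] B)
    (τ : SweedlerAlgebra k →ₗ[k] R) (g : TensorAlgebra k (SweedlerAlgebra k) →ₐ[k] B)
    (h1 : g (TensorAlgebra.ι k 1) = τ 1 • f (u α 1))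
    (hx : g (TensorAlgebra.ι k (x k)) = τ (x k) • f (u α (x k)))
    (hy : g (TensorAlgebra.ι k (y k)) = τ 1 • f (u α (y k)) + τ (y k) • f (u α (x k)))
    (hz : g (TensorAlgebra.ι k (z k)) = τ (x k) • f (u α (z k)) + τ (z k) • f (u α 1))
    (P : TensorAlgebra k (SweedlerAlgebra k)) :
    quatHom α h2 f (pointHom α τ P) = g P := by
  suffices ((quatHom α h2 f).restrictScalars k).comp (pointHom α τ) = g from
    AlgHom.congr_fun this P
  ext h
  simp only [LinearMap.comp_apply, AlgHom.toLinearMap_apply, AlgHom.comp_apply,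
    AlgHom.restrictScalars_apply, pointHom_ι]
  exact quatHom_pointLinear α h2 f τ (g.toLinearMap ∘ₗ TensorAlgebra.ι k) h1 hx hy hz h

/-- Specialization of the point `τ` along an algebra map. -/
def quatMap {R' : Type w} [CommRing R'] [Algebra k R'] (s : R →ₐ[k] R') :
    Quat α R →ₐ[k] Quat α R' where
  toFun q := ⟨s q.re, s q.imI, s q.imJ, s q.imK⟩
  map_one' := by ext <;> simp
  map_mul' p q := by ext <;> simp
  map_zero' := by ext <;> simp
  map_add' p q := by ext <;> simp
  commutes' r := by ext <;> simp [Algebra.algebraMap_eq_smul_one]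

/-- Functoriality of points in the coefficient ring. It lets the point over `S(t_H)` be specialized
to `k` and extended to the field of fractions. -/
theorem quatMap_pointHom {R' : Type w} [CommRing R'] [Algebra k R'] (s : R →ₐ[k] R')
    (τ : SweedlerAlgebra k →ₗ[k] R) (P : TensorAlgebra k (SweedlerAlgebra k)) :
    quatMap α s (pointHom α τ P) = pointHom α (s.toLinearMap ∘ₗ τ) P := by
  suffices (quatMap α s).comp (pointHom α τ) = pointHom α (s.toLinearMap ∘ₗ τ) from
    AlgHom.congr_fun this P
  ext h <;> simp [pointHom_ι, pointLinear, quatMap]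

end Maps

/-! ### Comodule algebra maps and identities -/

section Identities

variable (α : TwoCocycle k (SweedlerAlgebra k))

/-- The linear map `p ⊗ h ↦ ε(p) u_h`. -/
def counitTensor : TwistedAlgebra α ⊗[k] SweedlerAlgebra k →ₗ[k] TwistedAlgebra α :=
  (TensorProduct.lid k (TwistedAlgebra α)).toLinearMap ∘ₗ
    TensorProduct.map (Coalgebra.counit ∘ₗ (u α).symm.toLinearMap) (u α).toLinearMap

theorem coaction_u (h : SweedlerAlgebra k) :
    (ComoduleAlgebra.coaction : TwistedAlgebra α →ₐ[k] TwistedAlgebra α ⊗[k] SweedlerAlgebra k)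
      (u α h) = TensorProduct.map (u α).toLinearMap LinearMap.id (Coalgebra.comul h) :=
  coactionLinear_u α h

theorem coaction_ι (h : SweedlerAlgebra k) :
    (ComoduleAlgebra.coaction : TensorAlgebra k (SweedlerAlgebra k) →ₐ[k]
      TensorAlgebra k (SweedlerAlgebra k) ⊗[k] SweedlerAlgebra k) (TensorAlgebra.ι k h) =
      TensorProduct.map (TensorAlgebra.ι k) LinearMap.id (Coalgebra.comul h) :=
  TensorAlgebra.lift_ι_apply _ _

/-- The coaction is the coproduct of `H`, so this is the left counit axiom. It makes an element
recoverable from its coaction by applying `ε` to the first leg, which is the cofreeness used below.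
-/
theorem counitTensor_coaction (p : TwistedAlgebra α) :
    counitTensor α ((ComoduleAlgebra.coaction : TwistedAlgebra α →ₐ[k]
      TwistedAlgebra α ⊗[k] SweedlerAlgebra k) p) = p := by
  obtain ⟨h, rfl⟩ := (u α).surjective p
  rw [coaction_u]
  revert h
  suffices counitTensor α ∘ₗ TensorProduct.map (u α).toLinearMap LinearMap.id ∘ₗ
      Coalgebra.comul = (u α).toLinearMap from LinearMap.congr_fun this
  apply linearMap_ext <;>
  simp [counitTensor, comul_x, comul_y, comul_z, counit_x, counit_y, counit_z,
    Algebra.TensorProduct.one_def]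

/-- The linear map `h ↦ τ(h₁) u_{h₂}`. -/
def twistLinear (τ : SweedlerAlgebra k →ₗ[k] k) : SweedlerAlgebra k →ₗ[k] TwistedAlgebra α :=
  (TensorProduct.lid k (TwistedAlgebra α)).toLinearMap ∘ₗ
    TensorProduct.map τ (u α).toLinearMap ∘ₗ Coalgebra.comul

/-- Both sides are algebra maps, so colinearity is only needed on generators, where it is
coassociativity. -/
theorem isComoduleAlgHom_twist (τ : SweedlerAlgebra k →ₗ[k] k) :
    IsComoduleAlgHom k (SweedlerAlgebra k) (TensorAlgebra.lift k (twistLinear α τ)) := by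
  rw [IsComoduleAlgHom]
  apply TensorAlgebra.hom_ext
  apply linearMap_ext <;>
  simp [coaction_ι, coaction_u, twistLinear, comul_x, comul_y, comul_z,
    Algebra.TensorProduct.one_def, TensorProduct.smul_tmul', TensorProduct.add_tmul, smul_add] <;>
  abel

theorem quatHom_id_pointHom (h2 : (2 : k) ≠ 0) (τ : SweedlerAlgebra k →ₗ[k] k)
    (P : TensorAlgebra k (SweedlerAlgebra k)) :
    quatHom α h2 (AlgHom.id k (TwistedAlgebra α)) (pointHom α τ P) =
      TensorAlgebra.lift k (twistLinear α τ) P := by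
  apply quatHom_pointHom <;>
  simp [twistLinear, comul_x, comul_y, comul_z, Algebra.TensorProduct.one_def]

/-- The passage from quaternion coordinates to the basis `u_1, u_x, u_y, u_z` is unitriangular. -/
theorem quatHom_id_eq_zero (h2 : (2 : k) ≠ 0) (q : Quat α k)
    (hq : quatHom α h2 (AlgHom.id k (TwistedAlgebra α)) q = 0) : q = 0 := by
  rw [quatHom_apply] at hq
  simp only [AlgHom.id_apply, ← map_smul, ← map_add] at hq
  rw [LinearEquiv.map_eq_zero_iff] at hq
  have e1 := congrArg QuaternionAlgebra.re hq
  have e2 := congrArg QuaternionAlgebra.imI hq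
  have e3 := congrArg QuaternionAlgebra.imJ hq
  have e4 := congrArg QuaternionAlgebra.imK hq
  simp [x, y, z] at e1 e2 e3 e4
  ext
  · simpa [e4] using e1
  · simpa [e3] using e2
  · simpa using e3
  · simpa using e4

/-- By cofreeness the comodule algebra maps `f` correspond to linear forms `τ`, with `τ(h) =
ε(f(X_h))`, where `ε` is read on `ᵅH` through `u`. -/
theorem mem_identityIdeal_iff (h2 : (2 : k) ≠ 0) (P : TensorAlgebra k (SweedlerAlgebra k)) :
    P ∈ identityIdeal k (SweedlerAlgebra k) (TwistedAlgebra α) ↔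
      ∀ τ : SweedlerAlgebra k →ₗ[k] k, pointHom α τ P = 0 := by
  simp only [identityIdeal, Ideal.mem_iInf, RingHom.mem_ker]
  constructor
  · intro h τ
    apply quatHom_id_eq_zero α h2
    rw [quatHom_id_pointHom]
    exact h ⟨_, isComoduleAlgHom_twist α τ⟩
  · rintro h ⟨f, hf⟩
    -- Colinearity of `f` together with `counitTensor_coaction` gives `f(X_g) = ε(f(X_{g₁}))
    -- u_{g₂}`.
    have key : ∀ g, f (TensorAlgebra.ι k g) = counitTensor α
        (TensorProduct.map (f.toLinearMap ∘ₗ TensorAlgebra.ι k) LinearMap.id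
          (Coalgebra.comul g)) := by
      intro g
      have := AlgHom.congr_fun hf (TensorAlgebra.ι k g)
      rw [AlgHom.comp_apply, AlgHom.comp_apply, coaction_ι] at this
      rw [← counitTensor_coaction α (f (TensorAlgebra.ι k g)), this]
      generalize (Coalgebra.comul g : SweedlerAlgebra k ⊗[k] SweedlerAlgebra k) = s
      congr 1
      induction s with
      | zero => simp
      | add a b ha hb => simp only [map_add, ha, hb]
      | tmul a b => simp
    have := quatHom_pointHom α h2 (AlgHom.id k (TwistedAlgebra α))
      (Coalgebra.counit ∘ₗ (u α).symm.toLinearMap ∘ₗ f.toLinearMap ∘ₗ TensorAlgebra.ι k) f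
      (by rw [key]; simp [counitTensor, Algebra.TensorProduct.one_def])
      (by rw [key]; simp [counitTensor, comul_x])
      (by rw [key]; simp [counitTensor, comul_y])
      (by rw [key]; simp [counitTensor, comul_z]) P
    change f P = 0
    rw [← this, h, map_zero]

end Identities

/-! ### The symmetric algebra and its field of fractions -/

section Generic

/-- Over an infinite field an element of `S(t_H)` vanishes if all its evaluations do. -/
theorem symmetricAlgebra_eq_zero [Infinite k] {M : Type v} [AddCommGroup M] [Module k M]
    (s : SymmetricAlgebra k M)
    (h : ∀ τ : M →ₗ[k] k, SymmetricAlgebra.lift τ s = 0) : s = 0 := by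
  let b := Module.Free.chooseBasis k M
  apply (SymmetricAlgebra.equivMvPolynomial b).injective
  rw [map_zero]
  apply MvPolynomial.funext
  intro v
  rw [map_zero, ← h (b.constr k v)]
  have : ((MvPolynomial.aeval v).comp (SymmetricAlgebra.equivMvPolynomial b).toAlgHom) =
      SymmetricAlgebra.lift (b.constr k v) := by
    apply SymmetricAlgebra.algHom_ext
    apply b.ext
    intro i
    simp
  exact AlgHom.congr_fun this s

theorem genericField_algebraMap_injective :
    Function.Injective (algebraMap (SymmetricAlgebra k (SweedlerAlgebra k))
      (GenericField k (SweedlerAlgebra k))) :=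
  IsFractionRing.injective _ _

variable (α : TwoCocycle k (SweedlerAlgebra k))

/-- The generic point of `ᵅH₄`, with values in a quaternion algebra over `Frac S(t_H)`. -/
def genericHom : TensorAlgebra k (SweedlerAlgebra k) →ₐ[k]
    Quat α (GenericField k (SweedlerAlgebra k)) :=
  pointHom α (genericT k (SweedlerAlgebra k))

/-- The point with values in `S(t_H)` mediates: it specializes to every `τ`, its coordinates vanish
if all specializations do because `k` is infinite, and `S(t_H)` embeds in its field of fractions. -/
theorem mem_identityIdeal_iff_genericHom [Infinite k] (h2 : (2 : k) ≠ 0)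
    (P : TensorAlgebra k (SweedlerAlgebra k)) :
    P ∈ identityIdeal k (SweedlerAlgebra k) (TwistedAlgebra α) ↔ genericHom α P = 0 := by
  rw [mem_identityIdeal_iff α h2]
  have e1 := quatMap_pointHom α (IsScalarTower.toAlgHom k (SymmetricAlgebra k (SweedlerAlgebra k))
    (GenericField k (SweedlerAlgebra k))) (SymmetricAlgebra.ι k _) P
  have e2 : ∀ τ : SweedlerAlgebra k →ₗ[k] k, quatMap α (SymmetricAlgebra.lift τ)
      (pointHom α (SymmetricAlgebra.ι k _) P) = pointHom α τ P := by
    intro τ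
    rw [quatMap_pointHom]
    exact congrArg (fun σ => pointHom α σ P) (SymmetricAlgebra.lift_comp_ι τ)
  change _ = genericHom α P at e1
  rw [← e1]
  generalize pointHom α (SymmetricAlgebra.ι k (SweedlerAlgebra k)) P = q at e2
  constructor
  · intro h
    have : q = 0 := by
      ext <;> apply symmetricAlgebra_eq_zero <;> intro τ <;> have := (e2 τ).trans (h τ)
      · exact congrArg QuaternionAlgebra.re this
      · exact congrArg QuaternionAlgebra.imI this
      · exact congrArg QuaternionAlgebra.imJ this
      · exact congrArg QuaternionAlgebra.imK this
    rw [this, map_zero]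
  · intro h τ
    have : q = 0 := by
      ext <;> apply genericField_algebraMap_injective
      · exact (congrArg QuaternionAlgebra.re h).trans (map_zero _).symm
      · exact (congrArg QuaternionAlgebra.imI h).trans (map_zero _).symm
      · exact (congrArg QuaternionAlgebra.imJ h).trans (map_zero _).symm
      · exact (congrArg QuaternionAlgebra.imK h).trans (map_zero _).symm
    rw [← e2, this, map_zero]

/-- The inclusion of `ᵅH` in `Frac S(t_H) ⊗ ᵅH`. -/
abbrev includeTwisted : TwistedAlgebra α →ₐ[k]
    GenericField k (SweedlerAlgebra k) ⊗[k] TwistedAlgebra α :=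
  Algebra.TensorProduct.includeRight

/-- `μ_α` in quaternion coordinates. -/
theorem quatHom_genericHom (h2 : (2 : k) ≠ 0) (P : TensorAlgebra k (SweedlerAlgebra k)) :
    quatHom α h2 (includeTwisted α) (genericHom α P) = toGenericField α (universalMap α P) := by
  apply quatHom_pointHom α h2 (includeTwisted α) _ ((toGenericField α).comp (universalMap α)) <;>
  simp [universalMap, toGenericField, genericT, comul_x, comul_y, comul_z,
    Algebra.TensorProduct.one_def, TensorProduct.smul_tmul', ← Algebra.algebraMap_eq_smul_one]

end Generic

/-! ### Coordinates of points with values in a field -/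

section Coordinates

section PointValue

variable (α : TwoCocycle k (SweedlerAlgebra k)) {K : Type v} [CommRing K] [Algebra k K]
  (τ : SweedlerAlgebra k →ₗ[k] K)

/-- The `i`-coordinate of the image of `X_y`. -/
def coordY : K := shiftY α • τ 1 + τ (y k)

/-- The scalar coordinate of the image of `X_z`. -/
def coordZ : K := shiftZ α • τ (x k) + τ (z k)

/-- The images of `E`, `R`, `S`, `T`, `U` under a point. -/
def pointValue : SweedlerVar → K
  | .E => τ 1
  | .R => algebraMap k K (sqX α) * τ (x k) ^ 2
  | .S => algebraMap k K (sqX α) * coordY α τ ^ 2 + algebraMap k K (sqJ α) * τ 1 ^ 2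
  | .T => 2 * algebraMap k K (sqX α) * (τ (x k) * coordY α τ)
  | .U => 2 * algebraMap k K (sqX α) * τ (x k) ^ 2 * coordZ α τ

/-- Squares and anticommutators of pure quaternions are scalars. For `U`, the `k`-part of `Z`
anticommutes with `i`, so `XZ + ZX` is a multiple of `i`, and the factor `X` makes it scalar. -/
theorem pointHom_sweedlerElem (i : SweedlerVar) :
    pointHom α τ (sweedlerElem k i) = ⟨pointValue α τ i, 0, 0, 0⟩ := by
  cases i <;>
  simp only [sweedlerElem, map_mul, map_add, pointHom_ι, pointLinear_one, pointLinear_x,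
    pointLinear_y, pointLinear_z, pow_two] <;>
  ext <;> simp [pointValue, coordY, coordZ] <;> ring

theorem map_pointValue {K' : Type w} [CommRing K'] [Algebra k K'] (s : K →ₐ[k] K')
    (i : SweedlerVar) : s (pointValue α τ i) = pointValue α (s.toLinearMap ∘ₗ τ) i := by
  have e : s 2 = 2 := map_ofNat s 2
  cases i <;> simp [pointValue, coordY, coordZ, e]

end PointValue

variable (α : TwoCocycle k (SweedlerAlgebra k)) {K : Type v} [Field K] [Algebra k K]
  (τ : SweedlerAlgebra k →ₗ[k] K)

/-- The subalgebra `k[t_1^{±1}, t_x^{±2}, t_x v, q]`, where `v` and `q` are coordinates of the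
images of `X_y` and `X_z`. -/
def baseSubalgebra : Subalgebra k K :=
  Algebra.adjoin k {τ 1, (τ 1)⁻¹, τ (x k) ^ 2, (τ (x k) ^ 2)⁻¹, τ (x k) * coordY α τ, coordZ α τ}

theorem one_mem_base : τ 1 ∈ baseSubalgebra α τ := Algebra.subset_adjoin (by simp)

theorem one_inv_mem_base : (τ 1)⁻¹ ∈ baseSubalgebra α τ := Algebra.subset_adjoin (by simp)

theorem x_sq_mem_base : τ (x k) ^ 2 ∈ baseSubalgebra α τ := Algebra.subset_adjoin (by simp)

theorem x_sq_inv_mem_base : (τ (x k) ^ 2)⁻¹ ∈ baseSubalgebra α τ :=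
  Algebra.subset_adjoin (by simp)

theorem coordY_mem_base : τ (x k) * coordY α τ ∈ baseSubalgebra α τ :=
  Algebra.subset_adjoin (by simp)

theorem coordZ_mem_base : coordZ α τ ∈ baseSubalgebra α τ := Algebra.subset_adjoin (by simp)

/-- The subalgebra of the quaternion algebra whose `1`- and `j`-coordinates lie in the base and
whose `i`- and `k`-coordinates lie in `t_x` times the base. -/
def coordSubalgebra (hx : τ (x k) ≠ 0) : Subalgebra k (Quat α K) where
  carrier := {q | q.re ∈ baseSubalgebra α τ ∧ q.imI * τ (x k) ∈ baseSubalgebra α τ ∧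
    q.imJ ∈ baseSubalgebra α τ ∧ q.imK * τ (x k) ∈ baseSubalgebra α τ}
  mul_mem' := by
    rintro p q ⟨p0, p1, p2, p3⟩ ⟨q0, q1, q2, q3⟩
    have ha := (baseSubalgebra α τ).algebraMap_mem (sqX α)
    have hc := (baseSubalgebra α τ).algebraMap_mem (sqJ α)
    have hw := x_sq_inv_mem_base α τ
    -- The coordinates along `i` and `k` are odd in `t_x`. A product of two odd coordinates is even,
    -- by dividing by `t_x²`; `ev` and `ev'` treat odd times even.
    have odd : ∀ {r s : K}, r * τ (x k) ∈ baseSubalgebra α τ →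
        s * τ (x k) ∈ baseSubalgebra α τ → r * s ∈ baseSubalgebra α τ := by
      intro r s hr hs
      have := mul_mem (mul_mem hr hs) hw
      have e : r * τ (x k) * (s * τ (x k)) * (τ (x k) ^ 2)⁻¹ = r * s := by field_simp
      rwa [e] at this
    have ev : ∀ {r s : K}, r * τ (x k) ∈ baseSubalgebra α τ →
        s ∈ baseSubalgebra α τ → r * s * τ (x k) ∈ baseSubalgebra α τ := by
      intro r s hr hs
      have := mul_mem hr hs
      rwa [mul_right_comm] at this
    have ev' : ∀ {r s : K}, s * τ (x k) ∈ baseSubalgebra α τ →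
        r ∈ baseSubalgebra α τ → r * s * τ (x k) ∈ baseSubalgebra α τ := by
      intro r s hr hs
      have := mul_mem hs hr
      rwa [← mul_assoc] at this
    simp only [Set.mem_ofPred_eq, QuaternionAlgebra.re_mul, QuaternionAlgebra.imI_mul,
      QuaternionAlgebra.imJ_mul, QuaternionAlgebra.imK_mul, zero_mul, add_zero, add_mul, sub_mul, mul_assoc (algebraMap k K (sqX α)),
      mul_assoc (algebraMap k K (sqJ α))]
    exact ⟨sub_mem (add_mem (add_mem (mul_mem p0 q0) (mul_mem ha (odd p1 q1)))
        (mul_mem hc (mul_mem p2 q2))) (mul_mem ha (mul_mem hc (odd p3 q3))),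
      add_mem (sub_mem (add_mem (ev' q1 p0) (ev p1 q0)) (mul_mem hc (ev' q3 p2)))
        (mul_mem hc (ev p3 q2)),
      sub_mem (add_mem (add_mem (mul_mem p0 q2) (mul_mem ha (odd p1 q3))) (mul_mem p2 q0))
        (mul_mem ha (odd p3 q1)),
      add_mem (sub_mem (add_mem (ev' q3 p0) (ev p1 q2)) (ev' q1 p2)) (ev p3 q0)⟩
  add_mem' := by
    rintro p q ⟨p0, p1, p2, p3⟩ ⟨q0, q1, q2, q3⟩
    simp only [Set.mem_ofPred_eq, QuaternionAlgebra.re_add, QuaternionAlgebra.imI_add,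
      QuaternionAlgebra.imJ_add, QuaternionAlgebra.imK_add, add_mul]
    exact ⟨add_mem p0 q0, add_mem p1 q1, add_mem p2 q2, add_mem p3 q3⟩
  algebraMap_mem' r := by
    simp only [Set.mem_ofPred_eq, Algebra.algebraMap_eq_smul_one, QuaternionAlgebra.re_smul,
      QuaternionAlgebra.imI_smul, QuaternionAlgebra.imJ_smul, QuaternionAlgebra.imK_smul,
      QuaternionAlgebra.re_one, QuaternionAlgebra.imI_one, QuaternionAlgebra.imJ_one,
      QuaternionAlgebra.imK_one, smul_zero, zero_mul]
    exact ⟨Subalgebra.smul_mem _ (one_mem _) r, zero_mem _, zero_mem _, zero_mem _⟩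

theorem pointLinear_mem_coord (hx : τ (x k) ≠ 0) (h : SweedlerAlgebra k) :
    pointLinear α τ h ∈ coordSubalgebra α τ hx := by
  have e : h = h.re • (1 : SweedlerAlgebra k) + h.imI • x k + h.imJ • y k + h.imK • z k := by
    ext <;> simp [x, y, z]
  have m1 : pointLinear α τ 1 ∈ coordSubalgebra α τ hx := by
    rw [pointLinear_one]
    simpa [coordSubalgebra] using one_mem_base α τ
  have mx : pointLinear α τ (x k) ∈ coordSubalgebra α τ hx := by
    rw [pointLinear_x]
    simpa [coordSubalgebra, ← pow_two] using x_sq_mem_base α τ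
  have my : pointLinear α τ (y k) ∈ coordSubalgebra α τ hx := by
    rw [pointLinear_y]
    refine ⟨zero_mem _, ?_, one_mem_base α τ, by simp⟩
    rw [mul_comm]
    exact coordY_mem_base α τ
  have mz : pointLinear α τ (z k) ∈ coordSubalgebra α τ hx := by
    rw [pointLinear_z]
    refine ⟨coordZ_mem_base α τ, by simp, zero_mem _, ?_⟩
    rw [← pow_two]
    exact x_sq_mem_base α τ
  rw [e]
  simp only [map_add, map_smul]
  exact add_mem (add_mem (add_mem (Subalgebra.smul_mem _ m1 _) (Subalgebra.smul_mem _ mx _))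
    (Subalgebra.smul_mem _ my _)) (Subalgebra.smul_mem _ mz _)

theorem pointHom_mem_coord (hx : τ (x k) ≠ 0) (P : TensorAlgebra k (SweedlerAlgebra k)) :
    pointHom α τ P ∈ coordSubalgebra α τ hx := by
  induction P using TensorAlgebra.induction with
  | algebraMap r =>
    rw [AlgHom.commutes]
    exact Subalgebra.algebraMap_mem _ _
  | ι h =>
    rw [pointHom_ι]
    exact pointLinear_mem_coord α τ hx h
  | mul p q hp hq =>
    rw [map_mul]
    exact mul_mem hp hq
  | add p q hp hq =>
    rw [map_add]
    exact add_mem hp hq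

/-- Only scalars commute with the images of `X_x` and `X_y`. -/
theorem eq_scalar_of_commute (h2 : (2 : k) ≠ 0) (h1 : τ 1 ≠ 0) (hx : τ (x k) ≠ 0)
    (q : Quat α K) (qx : q * pointLinear α τ (x k) = pointLinear α τ (x k) * q)
    (qy : q * pointLinear α τ (y k) = pointLinear α τ (y k) * q) :
    q = ⟨q.re, 0, 0, 0⟩ := by
  have h2' : (2 : K) ≠ 0 := by
    have := (map_ne_zero (algebraMap k K)).2 h2
    rwa [map_ofNat] at this
  have ha : algebraMap k K (sqX α) ≠ 0 := (map_ne_zero (algebraMap k K)).2 (sqX_ne_zero α)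
  -- Commuting with `i` kills the `j`- and `k`-coordinates. The term `t_1 j` of `X_y` then kills the
  -- `i`-coordinate.
  have e1 := congrArg QuaternionAlgebra.imK qx
  have e2 := congrArg QuaternionAlgebra.imJ qx
  have e3 := congrArg QuaternionAlgebra.imK qy
  rw [pointLinear_x] at e1 e2
  rw [pointLinear_y] at e3
  simp at e1 e2 e3
  have hJ : q.imJ = 0 := by
    have : 2 * τ (x k) * q.imJ = 0 := by linear_combination -e1
    simpa [h2', hx] using this
  have hK : q.imK = 0 := by
    have : 2 * algebraMap k K (sqX α) * τ (x k) * q.imK = 0 := by linear_combination -e2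
    have hs : algebraMap k K (sqX α) ≠ 0 := ha
    rw [mul_eq_zero] at this
    exact this.resolve_left (mul_ne_zero (mul_ne_zero h2' hs) hx)
  have hI : q.imI = 0 := by
    rw [hJ] at e3
    have : 2 * τ 1 * q.imI = 0 := by linear_combination e3
    rw [mul_eq_zero] at this
    exact this.resolve_left (mul_ne_zero h2' h1)
  ext
  · rfl
  · exact hI
  · exact hJ
  · exact hK

end Coordinates

/-! ### The center -/

section Center

/-- A linear form that does not vanish at `h` extends to an algebra map on `S(t_H)` that does not
vanish at `t_h`. -/
theorem genericT_ne_zero (h : SweedlerAlgebra k) (hh : h ≠ 0) :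
    genericT k (SweedlerAlgebra k) h ≠ 0 := by
  intro h0
  have h1 : SymmetricAlgebra.ι k (SweedlerAlgebra k) h = 0 :=
    genericField_algebraMap_injective (h0.trans (map_zero _).symm)
  refine hh ((Module.forall_dual_apply_eq_zero_iff k h).1 fun f => ?_)
  rw [← SymmetricAlgebra.lift_ι_apply f h, h1, map_zero]

theorem genericT_one_ne_zero : genericT k (SweedlerAlgebra k) 1 ≠ 0 :=
  genericT_ne_zero 1 one_ne_zero

theorem genericT_x_ne_zero : genericT k (SweedlerAlgebra k) (x k) ≠ 0 := by
  refine genericT_ne_zero _ fun h => ?_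
  have := congrArg QuaternionAlgebra.imI h
  simp [x] at this

theorem mul_scalar_comm {K : Type v} [Field K] [Algebra k K] (α : TwoCocycle k (SweedlerAlgebra k))
    (r : K) (q : Quat α K) : q * ⟨r, 0, 0, 0⟩ = ⟨r, 0, 0, 0⟩ * q := by
  ext <;> simp [mul_comm]

theorem universalMk_surjective (α : TwoCocycle k (SweedlerAlgebra k)) :
    Function.Surjective (universalMk k (SweedlerAlgebra k) (TwistedAlgebra α)) :=
  Ideal.Quotient.mk_surjective

variable [Infinite k] (h2 : (2 : k) ≠ 0) (α : TwoCocycle k (SweedlerAlgebra k))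

/-- The embedding of `U_H^α` in a quaternion algebra over `Frac S(t_H)`. -/
def universalQuat : UniversalComoduleAlgebra k (SweedlerAlgebra k) (TwistedAlgebra α) →ₐ[k]
    Quat α (GenericField k (SweedlerAlgebra k)) :=
  Ideal.Quotient.liftₐ (identityIdeal k (SweedlerAlgebra k) (TwistedAlgebra α)) (genericHom α)
    fun P hP => (mem_identityIdeal_iff_genericHom α h2 P).1 hP

theorem universalQuat_mk (P : TensorAlgebra k (SweedlerAlgebra k)) :
    universalQuat h2 α (universalMk k (SweedlerAlgebra k) (TwistedAlgebra α) P) =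
      genericHom α P := rfl

theorem universalQuat_injective : Function.Injective (universalQuat h2 α) := by
  rw [injective_iff_map_eq_zero]
  intro p hp
  obtain ⟨P, rfl⟩ := universalMk_surjective α p
  rw [universalQuat_mk, ← mem_identityIdeal_iff_genericHom α h2] at hp
  exact Ideal.Quotient.eq_zero_iff_mem.2 hp

theorem universalQuat_center (p : sweedlerCenter α) :
    universalQuat h2 α p = ⟨(universalQuat h2 α p).re, 0, 0, 0⟩ := by
  have hp := Subalgebra.mem_center_iff.1 p.2
  have hι : ∀ h, universalQuat h2 α p * pointLinear α (genericT k (SweedlerAlgebra k)) h =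
      pointLinear α (genericT k (SweedlerAlgebra k)) h * universalQuat h2 α p := by
    intro h
    have := congrArg (universalQuat h2 α)
      (hp (universalMk k (SweedlerAlgebra k) (TwistedAlgebra α) (TensorAlgebra.ι k h)))
    rw [map_mul, map_mul, universalQuat_mk, genericHom, pointHom_ι] at this
    exact this.symm
  exact eq_scalar_of_commute α _ h2 genericT_one_ne_zero genericT_x_ne_zero _ (hι _) (hι _)

/-- Commutation can be checked in the quaternion algebra, where scalars are central, because `U_H^α`
embeds there. -/
theorem mem_center_of_genericHom (h2 : (2 : k) ≠ 0)
    (α : TwoCocycle k (SweedlerAlgebra k)) (P : TensorAlgebra k (SweedlerAlgebra k))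
    (r : GenericField k (SweedlerAlgebra k)) (hP : genericHom α P = ⟨r, 0, 0, 0⟩) :
    universalMk k (SweedlerAlgebra k) (TwistedAlgebra α) P ∈ sweedlerCenter α := by
  rw [Subalgebra.mem_center_iff]
  intro q
  apply universalQuat_injective h2 α
  rw [map_mul, map_mul, universalQuat_mk, hP]
  exact mul_scalar_comm α r _

theorem sweedlerClass_mem_center (h2 : (2 : k) ≠ 0)
    (α : TwoCocycle k (SweedlerAlgebra k)) (i : SweedlerVar) : sweedlerClass α i ∈ sweedlerCenter α :=
  mem_center_of_genericHom h2 α _ _ (pointHom_sweedlerElem α _ i)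

/-- The embedding of the center `Z_H^α` in `Frac S(t_H)`. -/
def centerHom : sweedlerCenter α →ₐ[k] GenericField k (SweedlerAlgebra k) :=
  AlgHom.ofLinearMap
    { toFun := fun p => (universalQuat h2 α p).re
      map_add' := fun p q => by simp
      map_smul' := fun r p => by simp }
    (by simp)
    -- The real part is multiplicative here because central elements have scalar image.
    (fun p q => by
      have := universalQuat_center h2 α p
      simp only [LinearMap.coe_mk, AddHom.coe_mk, Subalgebra.coe_mul, map_mul]
      rw [this]
      simp)

theorem centerHom_apply (p : sweedlerCenter α) :
    centerHom h2 α p = (universalQuat h2 α p).re := rfl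

theorem universalQuat_eq_centerHom (p : sweedlerCenter α) :
    universalQuat h2 α p = ⟨centerHom h2 α p, 0, 0, 0⟩ :=
  universalQuat_center h2 α p

theorem centerHom_injective : Function.Injective (centerHom h2 α) := by
  intro p q hpq
  apply Subtype.ext
  apply universalQuat_injective h2 α
  rw [universalQuat_eq_centerHom, universalQuat_eq_centerHom, hpq]

theorem centerHom_sweedlerClass (i : SweedlerVar) :
    centerHom h2 α ⟨sweedlerClass α i, sweedlerClass_mem_center h2 α i⟩ =
      pointValue α (genericT k (SweedlerAlgebra k)) i :=
  congrArg QuaternionAlgebra.re (pointHom_sweedlerElem α (genericT k (SweedlerAlgebra k)) i)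

/-- The whole image of `T(X_H)` lies in `coordSubalgebra`, whose `1`-coordinates are in the base. -/
theorem centerHom_mem_base (p : sweedlerCenter α) :
    centerHom h2 α p ∈ baseSubalgebra α (genericT k (SweedlerAlgebra k)) := by
  obtain ⟨P, hP⟩ := universalMk_surjective α p
  rw [centerHom_apply, ← hP, universalQuat_mk]
  exact (pointHom_mem_coord α _ genericT_x_ne_zero P).1

/-- `μ_α` on elements with central class. -/
theorem universalMap_center (P : TensorAlgebra k (SweedlerAlgebra k))
    (hP : universalMk k (SweedlerAlgebra k) (TwistedAlgebra α) P ∈ sweedlerCenter α) :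
    toGenericField α (universalMap α P) =
      centerHom h2 α ⟨_, hP⟩ ⊗ₜ[k] (1 : TwistedAlgebra α) := by
  have := universalQuat_eq_centerHom h2 α ⟨_, hP⟩
  rw [universalQuat_mk] at this
  rw [← quatHom_genericHom α h2, this, quatHom_apply]
  simp [TensorProduct.smul_tmul', u_one]

end Center

/-! ### Localizations of domains in a field -/

section Localization

variable {A : Type v} [CommRing A] [Algebra k A] {K : Type w} [Field K] [Algebra k K]

/-- The extension of a map to a field to the localization at two elements. -/
def localizationHom (f : A →ₐ[k] K) (e r : A) (he : f e ≠ 0) (hr : f r ≠ 0) :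
    Localization (Submonoid.closure {e, r}) →ₐ[k] K :=
  IsLocalization.liftAlgHom (M := Submonoid.closure {e, r}) (f := f) fun s => by
    have : Submonoid.closure {e, r} ≤ (IsUnit.submonoid K).comap f := by
      rw [Submonoid.closure_le]
      rintro s (rfl | rfl)
      · exact he.isUnit
      · exact hr.isUnit
    exact this s.2

variable (f : A →ₐ[k] K) (e r : A) (he : f e ≠ 0) (hr : f r ≠ 0)

theorem localizationHom_algebraMap (p : A) :
    localizationHom f e r he hr (algebraMap A _ p) = f p :=
  IsLocalization.lift_eq _ p

theorem localizationHom_injective (hf : Function.Injective f) :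
    Function.Injective (localizationHom f e r he hr) := by
  rw [injective_iff_map_eq_zero]
  intro p hp
  obtain ⟨⟨q, s⟩, hq⟩ := IsLocalization.surj (Submonoid.closure {e, r}) p
  have := congrArg (localizationHom f e r he hr) hq
  rw [map_mul, hp, zero_mul, localizationHom_algebraMap] at this
  rw [hf (this.symm.trans (map_zero f).symm), map_zero] at hq
  exact (IsLocalization.map_units _ s).mul_left_eq_zero.1 hq

theorem localizationHom_mem (S : Subalgebra k K) (hf : ∀ p, f p ∈ S) (he' : (f e)⁻¹ ∈ S)
    (hr' : (f r)⁻¹ ∈ S) (p : Localization (Submonoid.closure {e, r})) :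
    localizationHom f e r he hr p ∈ S := by
  have key : ∀ s ∈ Submonoid.closure {e, r}, f s ≠ 0 ∧ (f s)⁻¹ ∈ S := by
    intro s hs
    induction hs using Submonoid.closure_induction with
    | mem s hs =>
      rcases hs with rfl | rfl
      · exact ⟨he, he'⟩
      · exact ⟨hr, hr'⟩
    | one => simp
    | mul s t _ _ hs ht =>
      rw [map_mul, mul_inv]
      exact ⟨mul_ne_zero hs.1 ht.1, mul_mem hs.2 ht.2⟩
  obtain ⟨⟨q, s⟩, hq⟩ := IsLocalization.surj (Submonoid.closure {e, r}) p
  have := congrArg (localizationHom f e r he hr) hq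
  rw [map_mul, localizationHom_algebraMap, localizationHom_algebraMap] at this
  obtain ⟨h0, hs⟩ := key s s.2
  rw [eq_div_of_mul_eq h0 this, div_eq_mul_inv]
  exact mul_mem (hf q) hs

theorem inv_mem_range_localizationHom (p : A) (hp : p ∈ ({e, r} : Set A)) :
    (f p)⁻¹ ∈ (localizationHom f e r he hr).range := by
  let s : Submonoid.closure {e, r} := ⟨p, Submonoid.subset_closure hp⟩
  refine ⟨IsLocalization.mk' _ 1 s, ?_⟩
  apply eq_inv_of_mul_eq_one_left
  rw [← localizationHom_algebraMap f e r he hr p]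
  refine (map_mul (localizationHom f e r he hr) _ _).symm.trans ?_
  have := IsLocalization.mk'_spec (Localization (Submonoid.closure {e, r})) 1 s
  rw [this, map_one, map_one]

/-- Two embeddings with the same range give an isomorphism. -/
def equivOfRangeEq {B : Type*} {C : Type*} [CommRing B] [Algebra k B] [CommRing C] [Algebra k C]
    (f : A →ₐ[k] C) (g : B →ₐ[k] C) (hf : Function.Injective f) (hg : Function.Injective g)
    (h : f.range = g.range) : A ≃ₐ[k] B :=
  ((AlgEquiv.ofInjective f hf).trans (Subalgebra.equivOfEq _ _ h)).trans
    (AlgEquiv.ofInjective g hg).symm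

theorem apply_equivOfRangeEq {B : Type*} {C : Type*} [CommRing B] [Algebra k B] [CommRing C]
    [Algebra k C] (f : A →ₐ[k] C) (g : B →ₐ[k] C) (hf : Function.Injective f)
    (hg : Function.Injective g) (h : f.range = g.range) (p : A) :
    g (equivOfRangeEq f g hf hg h p) = f p := by
  have := congrArg Subtype.val ((AlgEquiv.ofInjective g hg).apply_symm_apply
    (Subalgebra.equivOfEq _ _ h (AlgEquiv.ofInjective f hf p)))
  exact this

end Localization

/-! ### The image of the localized center in `Frac S(t_H)`. -/

section CenterLocalization

variable {K : Type v} [Field K] [Algebra k K]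

/-- The base subalgebra is generated by the values of the five generators at a point and the
inverses of the first two. -/
theorem base_le_of_pointValue (α : TwoCocycle k (SweedlerAlgebra k)) (h2 : (2 : k) ≠ 0)
    (τ : SweedlerAlgebra k →ₗ[k] K) (hx : τ (x k) ≠ 0) (S : Subalgebra k K)
    (h : ∀ i, pointValue α τ i ∈ S) (hE : (pointValue α τ .E)⁻¹ ∈ S)
    (hR : (pointValue α τ .R)⁻¹ ∈ S) : baseSubalgebra α τ ≤ S := by
  have ha := sqX_ne_zero α
  have ha' : algebraMap k K (sqX α) ≠ 0 := (map_ne_zero (algebraMap k K)).2 ha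
  have h2' : (2 : K) ≠ 0 := by
    have := (map_ne_zero (algebraMap k K)).2 h2
    rwa [map_ofNat] at this
  have hX := S.algebraMap_mem (sqX α)
  have hXi := S.algebraMap_mem (sqX α)⁻¹
  have h2i := S.algebraMap_mem (2 : k)⁻¹
  rw [map_inv₀] at hXi h2i
  rw [map_ofNat] at h2i
  rw [baseSubalgebra, Algebra.adjoin_le_iff]
  have aux : ∀ {p q : K}, q ∈ S → q = p → p ∈ S := fun hq e => e ▸ hq
  rintro s (rfl | rfl | rfl | rfl | rfl | rfl)
  · exact h .E
  · exact hE
  -- With `a' = u_x²`: `t_x² = R/a'`, `t_x v = T/(2a')` and `q = U/(2R)`. The value of `S` is not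
  -- needed.
  · exact aux (mul_mem hXi (h .R)) (by simp only [pointValue]; field_simp)
  · exact aux (mul_mem hX hR) (by simp only [pointValue]; field_simp)
  · exact aux (mul_mem (mul_mem h2i hXi) (h .T)) (by simp only [pointValue]; field_simp)
  · exact aux (mul_mem (mul_mem h2i hR) (h .U)) (by simp only [pointValue]; field_simp)

theorem pointValue_inv_mem_base (α : TwoCocycle k (SweedlerAlgebra k))
    (τ : SweedlerAlgebra k →ₗ[k] K) :
    (pointValue α τ .E)⁻¹ ∈ baseSubalgebra α τ ∧ (pointValue α τ .R)⁻¹ ∈ baseSubalgebra α τ := by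
  refine ⟨one_inv_mem_base α τ, ?_⟩
  have := (baseSubalgebra α τ).algebraMap_mem (sqX α)⁻¹
  rw [map_inv₀] at this
  simp only [pointValue, mul_inv]
  exact mul_mem this (x_sq_inv_mem_base α τ)

theorem pointValue_ne_zero (α : TwoCocycle k (SweedlerAlgebra k))
    (τ : SweedlerAlgebra k →ₗ[k] K) (h1 : τ 1 ≠ 0) (hx : τ (x k) ≠ 0) :
    pointValue α τ .E ≠ 0 ∧ pointValue α τ .R ≠ 0 :=
  ⟨h1, mul_ne_zero ((map_ne_zero (algebraMap k K)).2 (sqX_ne_zero α)) (pow_ne_zero 2 hx)⟩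

variable [Infinite k] (h2 : (2 : k) ≠ 0) (α : TwoCocycle k (SweedlerAlgebra k))

/-- The embedding of `Z_H^α[E⁻¹, R⁻¹]` in `Frac S(t_H)`. -/
def centerLocalizationHom :
    SweedlerCenterLocalization α ⟨_, sweedlerClass_mem_center h2 α .E⟩
      ⟨_, sweedlerClass_mem_center h2 α .R⟩ →ₐ[k] GenericField k (SweedlerAlgebra k) :=
  localizationHom (centerHom h2 α) _ _
    (by
      rw [centerHom_sweedlerClass]
      exact (pointValue_ne_zero α _ genericT_one_ne_zero genericT_x_ne_zero).1)
    (by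
      rw [centerHom_sweedlerClass]
      exact (pointValue_ne_zero α _ genericT_one_ne_zero genericT_x_ne_zero).2)

theorem centerLocalizationHom_algebraMap (p : sweedlerCenter α) :
    centerLocalizationHom h2 α (algebraMap _ _ p) = centerHom h2 α p :=
  localizationHom_algebraMap _ _ _ _ _ p

theorem centerLocalizationHom_injective : Function.Injective (centerLocalizationHom h2 α) :=
  localizationHom_injective _ _ _ _ _ (centerHom_injective h2 α)

/-- The center lies in the base, where `E` and `R` are invertible; conversely the values of the five
central elements and the two inverses generate the base. -/
theorem range_centerLocalizationHom :
    (centerLocalizationHom h2 α).range =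
      baseSubalgebra α (genericT k (SweedlerAlgebra k)) := by
  apply le_antisymm
  · rintro _ ⟨p, rfl⟩
    apply localizationHom_mem
    · exact centerHom_mem_base h2 α
    · rw [centerHom_sweedlerClass]
      exact (pointValue_inv_mem_base α _).1
    · rw [centerHom_sweedlerClass]
      exact (pointValue_inv_mem_base α _).2
  · apply base_le_of_pointValue α h2 _ genericT_x_ne_zero
    · intro i
      refine ⟨algebraMap (sweedlerCenter α) _ ⟨_, sweedlerClass_mem_center h2 α i⟩, ?_⟩
      exact (centerLocalizationHom_algebraMap h2 α _).trans (centerHom_sweedlerClass h2 α i)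
    · rw [← centerHom_sweedlerClass h2 α]
      exact inv_mem_range_localizationHom _ _ _ _ _ _ (by simp)
    · rw [← centerHom_sweedlerClass h2 α]
      exact inv_mem_range_localizationHom _ _ _ _ _ _ (by simp)

end CenterLocalization

/-! ### The generic base algebra -/

section Inverse

theorem genericT_mul_inv :
    WithConv.toConv (genericT k (SweedlerAlgebra k)) *
      WithConv.toConv (genericTInv k (SweedlerAlgebra k)) = 1 :=
  Ring.mul_inverse_cancel _ (isUnit_genericT_sweedler k)

theorem genericTInv_mul :
    WithConv.toConv (genericTInv k (SweedlerAlgebra k)) *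
      WithConv.toConv (genericT k (SweedlerAlgebra k)) = 1 :=
  Ring.inverse_mul_cancel _ (isUnit_genericT_sweedler k)

theorem conv_apply {C A : Type*} [AddCommGroup C] [Module k C] [Coalgebra k C] [CommRing A]
    [Algebra k A] {f g : C →ₗ[k] A} (h : WithConv.toConv f * WithConv.toConv g = 1) (c : C) :
    LinearMap.mul' k A (TensorProduct.map f g (Coalgebra.comul c)) =
      algebraMap k A (Coalgebra.counit c) :=
  congrArg (fun f : WithConv (C →ₗ[k] A) => f.ofConv c) h

theorem genericTInv_one : genericTInv k (SweedlerAlgebra k) (1 : SweedlerAlgebra k) = (genericT k (SweedlerAlgebra k) (1 : SweedlerAlgebra k))⁻¹ := by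
  have h := conv_apply (genericT_mul_inv (k := k)) 1
  simp only [Bialgebra.comul_one, Algebra.TensorProduct.one_def, TensorProduct.map_tmul,
    LinearMap.mul'_apply, Bialgebra.counit_one, map_one] at h
  exact eq_inv_of_mul_eq_one_right h

theorem genericTInv_x : genericTInv k (SweedlerAlgebra k) (x k) = (genericT k (SweedlerAlgebra k) (x k))⁻¹ := by
  have h := conv_apply (genericT_mul_inv (k := k)) (x k)
  simp only [comul_x, TensorProduct.map_tmul, LinearMap.mul'_apply, counit_x, map_one] at h
  exact eq_inv_of_mul_eq_one_right h

/-- The convolution identity at `y` reads `t_1 t⁻¹_y + t_y t⁻¹_x = 0`, and `t⁻¹_x` is already known.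
-/
theorem genericTInv_y :
    genericTInv k (SweedlerAlgebra k) (y k) = -(genericT k (SweedlerAlgebra k) (y k) * (genericT k (SweedlerAlgebra k) (1 : SweedlerAlgebra k))⁻¹ * (genericT k (SweedlerAlgebra k) (x k))⁻¹) := by
  have h := conv_apply (genericT_mul_inv (k := k)) (y k)
  simp only [comul_y, map_add, TensorProduct.map_tmul, LinearMap.mul'_apply, counit_y, map_zero,
    genericTInv_x] at h
  have h1 := genericT_one_ne_zero (k := k)
  have hx := genericT_x_ne_zero (k := k)
  field_simp
  field_simp at h
  linear_combination h

theorem genericTInv_z :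
    genericTInv k (SweedlerAlgebra k) (z k) = -(genericT k (SweedlerAlgebra k) (z k) * (genericT k (SweedlerAlgebra k) (1 : SweedlerAlgebra k))⁻¹ * (genericT k (SweedlerAlgebra k) (x k))⁻¹) := by
  have h := conv_apply (genericT_mul_inv (k := k)) (z k)
  simp only [comul_z, map_add, TensorProduct.map_tmul, LinearMap.mul'_apply, counit_z, map_zero,
    genericTInv_one] at h
  have h1 := genericT_one_ne_zero (k := k)
  have hx := genericT_x_ne_zero (k := k)
  field_simp
  field_simp at h
  linear_combination h

end Inverse

/-! ### The generic cocycle in quaternion coordinates. -/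

section Cocycle

variable (α : TwoCocycle k (SweedlerAlgebra k))

/-- The linear map `c ⊗ u_h ↦ c t⁻¹_h`. -/
def genericCounit : GenericField k (SweedlerAlgebra k) ⊗[k] TwistedAlgebra α →ₗ[k]
    GenericField k (SweedlerAlgebra k) :=
  LinearMap.mul' k _ ∘ₗ TensorProduct.map LinearMap.id
    (genericTInv k (SweedlerAlgebra k) ∘ₗ (u α).symm.toLinearMap)

theorem toGenericField_universalMap_ι (h : SweedlerAlgebra k) :
    toGenericField α (universalMap α (TensorAlgebra.ι k h)) =
      TensorProduct.map (genericT k (SweedlerAlgebra k)) (u α).toLinearMap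
        (Coalgebra.comul h) := by
  simp only [universalMap, TensorAlgebra.lift_ι_apply, LinearMap.comp_apply]
  generalize (Coalgebra.comul h : SweedlerAlgebra k ⊗[k] SweedlerAlgebra k) = s
  induction s with
  | zero => simp
  | add a b ha hb => simp only [map_add, ha, hb]
  | tmul a b => simp [toGenericField, genericT]

theorem genericTInv_twistedMul (t : SweedlerAlgebra k ⊗[k] SweedlerAlgebra k) :
    genericTInv k (SweedlerAlgebra k) (twistedMul α.form t) =
      (WithConv.toConv (Algebra.linearMap k (GenericField k (SweedlerAlgebra k)) ∘ₗ α.form) *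
        WithConv.toConv (genericTInv k (SweedlerAlgebra k) ∘ₗ
          LinearMap.mul' k (SweedlerAlgebra k))).ofConv t := by
  simp only [twistedMul, LinearMap.comp_apply, LinearMap.convMul_def, LinearEquiv.coe_coe]
  generalize (Coalgebra.comul t : (SweedlerAlgebra k ⊗[k] SweedlerAlgebra k) ⊗[k]
    (SweedlerAlgebra k ⊗[k] SweedlerAlgebra k)) = s
  induction s with
  | zero => simp
  | add a b ha hb => simp only [map_add, ha, hb]
  | tmul a b =>
    rw [TensorProduct.map_tmul, TensorProduct.lid_tmul, map_smul, Algebra.smul_def]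
    rfl

/-- `σ(g, h)` is the image of the product of the generic elements under `c ⊗ u_h ↦ c t⁻¹_h`. -/
theorem genericCocycle_eq_counit (g h : SweedlerAlgebra k) :
    genericCocycle α (g ⊗ₜ h) = genericCounit α (toGenericField α
      (universalMap α (TensorAlgebra.ι k g * TensorAlgebra.ι k h))) := by
  rw [map_mul, map_mul, toGenericField_universalMap_ι, toGenericField_universalMap_ι,
    genericCocycle, mul_assoc]
  -- The last two factors of `σ` merge into `t⁻¹` applied to the twisted product, that is, to the
  -- product of `ᵅH`.
  have e : (WithConv.toConv (Algebra.linearMap k (GenericField k (SweedlerAlgebra k)) ∘ₗ α.form) *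
        WithConv.toConv (genericTInv k (SweedlerAlgebra k) ∘ₗ
          LinearMap.mul' k (SweedlerAlgebra k))) =
      WithConv.toConv (genericTInv k (SweedlerAlgebra k) ∘ₗ twistedMul α.form) := by
    apply WithConv.ofConv_injective
    exact LinearMap.ext fun t => (genericTInv_twistedMul α t).symm
  rw [e, LinearMap.convMul_def]
  have key : ∀ X Y : SweedlerAlgebra k ⊗[k] SweedlerAlgebra k,
      LinearMap.mul' k (GenericField k (SweedlerAlgebra k))
        (TensorProduct.map (LinearMap.mul' k (GenericField k (SweedlerAlgebra k)) ∘ₗ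
          TensorProduct.map (genericT k (SweedlerAlgebra k)) (genericT k (SweedlerAlgebra k)))
          (genericTInv k (SweedlerAlgebra k) ∘ₗ twistedMul α.form)
          (TensorProduct.tensorTensorTensorComm k _ _ _ _ (X ⊗ₜ Y))) =
      genericCounit α (TensorProduct.map (genericT k (SweedlerAlgebra k)) (u α).toLinearMap X *
        TensorProduct.map (genericT k (SweedlerAlgebra k)) (u α).toLinearMap Y) := by
    intro X Y
    induction X with
    | zero => simp
    | add a b ha hb => simp only [map_add, TensorProduct.add_tmul, add_mul, ha, hb]
    | tmul x1 x2 =>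
    induction Y with
    | zero => simp
    | add a b ha hb => simp only [map_add, TensorProduct.tmul_add, mul_add, ha, hb]
    | tmul y1 y2 => simp [genericCounit, u_mul_u]
  refine Eq.trans ?_ (key _ _)
  simp only [LinearMap.comp_apply, TensorProduct.comul_tmul,
    TensorProduct.AlgebraTensorModule.tensorTensorTensorComm_eq]

/-- The map `c ⊗ u_h ↦ c t⁻¹_h` in quaternion coordinates. -/
theorem genericCounit_quatHom (h2 : (2 : k) ≠ 0)
    (q : Quat α (GenericField k (SweedlerAlgebra k))) :
    genericCounit α (quatHom α h2 (includeTwisted α) q) =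
      q.re * (genericT k (SweedlerAlgebra k) 1)⁻¹ +
      q.imI * genericT k (SweedlerAlgebra k) (x k) *
        (genericT k (SweedlerAlgebra k) (x k) ^ 2)⁻¹ -
      q.imJ * (genericT k (SweedlerAlgebra k) (x k) *
        coordY α (genericT k (SweedlerAlgebra k))) * (genericT k (SweedlerAlgebra k) 1)⁻¹ *
        (genericT k (SweedlerAlgebra k) (x k) ^ 2)⁻¹ -
      q.imK * genericT k (SweedlerAlgebra k) (x k) *
        coordZ α (genericT k (SweedlerAlgebra k)) * (genericT k (SweedlerAlgebra k) 1)⁻¹ *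
        (genericT k (SweedlerAlgebra k) (x k) ^ 2)⁻¹ := by
  have h1 := genericT_one_ne_zero (k := k)
  have hx := genericT_x_ne_zero (k := k)
  rw [quatHom_apply]
  simp only [includeTwisted, Algebra.TensorProduct.includeRight_apply, TensorProduct.smul_tmul',
    genericCounit, map_add, LinearMap.comp_apply, TensorProduct.map_tmul, LinearMap.mul'_apply,
    LinearMap.id_apply, LinearEquiv.coe_coe, LinearEquiv.symm_apply_apply, genericTInv_one,
    genericTInv_x, genericTInv_y, genericTInv_z, smul_eq_mul, mul_one, coordY, coordZ]
  simp only [Algebra.smul_def]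
  field_simp
  ring

/-- The formula `genericCounit_quatHom` keeps `t_x` and `t_x⁻²` uncancelled, so that each term is
visibly a product of elements of the base. -/
theorem genericCounit_mem_base (h2 : (2 : k) ≠ 0)
    (q : Quat α (GenericField k (SweedlerAlgebra k)))
    (hq : q ∈ coordSubalgebra α (genericT k (SweedlerAlgebra k)) genericT_x_ne_zero) :
    genericCounit α (quatHom α h2 (includeTwisted α) q) ∈
      baseSubalgebra α (genericT k (SweedlerAlgebra k)) := by
  obtain ⟨q0, q1, q2, q3⟩ := hq
  rw [genericCounit_quatHom]
  have h1 := one_inv_mem_base α (genericT k (SweedlerAlgebra k))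
  have hx := x_sq_inv_mem_base α (genericT k (SweedlerAlgebra k))
  have hy := coordY_mem_base α (genericT k (SweedlerAlgebra k))
  have hz := coordZ_mem_base α (genericT k (SweedlerAlgebra k))
  exact sub_mem (sub_mem (add_mem (mul_mem q0 h1) (mul_mem q1 hx))
    (mul_mem (mul_mem (mul_mem q2 hy) h1) hx)) (mul_mem (mul_mem (mul_mem q3 hz) h1) hx)

theorem genericCocycle_eq_quat (h2 : (2 : k) ≠ 0) (g h : SweedlerAlgebra k) :
    genericCocycle α (g ⊗ₜ h) = genericCounit α (quatHom α h2 (includeTwisted α)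
      (pointLinear α (genericT k (SweedlerAlgebra k)) g *
        pointLinear α (genericT k (SweedlerAlgebra k)) h)) := by
  rw [genericCocycle_eq_counit, ← quatHom_genericHom α h2, genericHom, map_mul, pointHom_ι,
    pointHom_ι]

theorem genericCocycle_mem_base (h2 : (2 : k) ≠ 0) (g h : SweedlerAlgebra k) :
    genericCocycle α (g ⊗ₜ h) ∈ baseSubalgebra α (genericT k (SweedlerAlgebra k)) := by
  rw [genericCocycle_eq_quat α h2]
  exact genericCounit_mem_base α h2 _ (mul_mem (pointLinear_mem_coord α _ _ g)
    (pointLinear_mem_coord α _ _ h))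

theorem genericCocycle_one_one (h2 : (2 : k) ≠ 0) :
    genericCocycle α (1 ⊗ₜ 1) = genericT k (SweedlerAlgebra k) 1 := by
  have h1 := genericT_one_ne_zero (k := k)
  rw [genericCocycle_eq_quat α h2, genericCounit_quatHom, pointLinear_one]
  simp [h1]

theorem genericCocycle_one_x (h2 : (2 : k) ≠ 0) :
    genericCocycle α (1 ⊗ₜ x k) = genericT k (SweedlerAlgebra k) 1 := by
  have hx := genericT_x_ne_zero (k := k)
  rw [genericCocycle_eq_quat α h2, genericCounit_quatHom, pointLinear_one, pointLinear_x]
  simp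
  field_simp

theorem genericCocycle_x_one (h2 : (2 : k) ≠ 0) :
    genericCocycle α (x k ⊗ₜ 1) = genericT k (SweedlerAlgebra k) 1 := by
  have hx := genericT_x_ne_zero (k := k)
  rw [genericCocycle_eq_quat α h2, genericCounit_quatHom, pointLinear_one, pointLinear_x]
  simp
  field_simp

theorem genericCocycle_x_x (h2 : (2 : k) ≠ 0) :
    genericCocycle α (x k ⊗ₜ x k) = pointValue α (genericT k (SweedlerAlgebra k)) .R *
      (genericT k (SweedlerAlgebra k) 1)⁻¹ := by
  rw [genericCocycle_eq_quat α h2, genericCounit_quatHom, pointLinear_x]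
  simp only [QuaternionAlgebra.re_mul, QuaternionAlgebra.imI_mul, QuaternionAlgebra.imJ_mul,
    QuaternionAlgebra.imK_mul, pointValue]
  ring

theorem genericCocycle_y_y (h2 : (2 : k) ≠ 0) :
    genericCocycle α (y k ⊗ₜ y k) = pointValue α (genericT k (SweedlerAlgebra k)) .S *
      (genericT k (SweedlerAlgebra k) 1)⁻¹ := by
  rw [genericCocycle_eq_quat α h2, genericCounit_quatHom, pointLinear_y]
  simp [pointValue, coordY]
  ring

/-- The anticommutator of `X_x` and `X_y` is the scalar `T`, and a scalar is merely divided by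
`t_1`. -/
theorem genericCocycle_x_y_add (h2 : (2 : k) ≠ 0) :
    genericCocycle α (x k ⊗ₜ y k) + genericCocycle α (y k ⊗ₜ x k) =
      pointValue α (genericT k (SweedlerAlgebra k)) .T *
      (genericT k (SweedlerAlgebra k) 1)⁻¹ := by
  rw [genericCocycle_eq_quat α h2, genericCocycle_eq_quat α h2, ← map_add, ← map_add,
    genericCounit_quatHom, pointLinear_x, pointLinear_y]
  simp [pointValue, coordY]
  ring

/-- The anticommutator of `X_x` and `X_z` is `2 q t_x i`, which `c ⊗ u_h ↦ c t⁻¹_h` sends to `2q =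
U/R`. -/
theorem genericCocycle_x_z_add (h2 : (2 : k) ≠ 0) :
    pointValue α (genericT k (SweedlerAlgebra k)) .R *
      (genericCocycle α (x k ⊗ₜ z k) + genericCocycle α (z k ⊗ₜ x k)) =
      pointValue α (genericT k (SweedlerAlgebra k)) .U := by
  have hx := genericT_x_ne_zero (k := k)
  rw [genericCocycle_eq_quat α h2, genericCocycle_eq_quat α h2, ← map_add, ← map_add,
    genericCounit_quatHom, pointLinear_x, pointLinear_z]
  simp [pointValue, coordZ]
  field_simp
  ring

/-- The six factors cancel in pairs from the middle outwards: `hB`, then `hα`, then `hA`. The pair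
with `t` and `t⁻¹` on products cancels because multiplication is a coalgebra map. -/
theorem genericCocycle_mul_inv :
    WithConv.toConv (genericCocycle α) * WithConv.toConv (genericCocycleInv α) = 1 := by
  have hA : WithConv.toConv (LinearMap.mul' k (GenericField k (SweedlerAlgebra k)) ∘ₗ
        TensorProduct.map (genericT k (SweedlerAlgebra k)) (genericT k (SweedlerAlgebra k))) *
      WithConv.toConv (LinearMap.mul' k (GenericField k (SweedlerAlgebra k)) ∘ₗ
        TensorProduct.map (genericTInv k (SweedlerAlgebra k))
          (genericTInv k (SweedlerAlgebra k))) = 1 := by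
    have e1 := LinearMap.algHom_comp_convMul_distrib
      (Algebra.TensorProduct.lmul' k (S := GenericField k (SweedlerAlgebra k)))
      (WithConv.toConv (TensorProduct.map (genericT k (SweedlerAlgebra k))
        (genericT k (SweedlerAlgebra k))))
      (WithConv.toConv (TensorProduct.map (genericTInv k (SweedlerAlgebra k))
        (genericTInv k (SweedlerAlgebra k))))
    have e2 := TensorProduct.map_convMul_map
      (f := WithConv.toConv (genericT k (SweedlerAlgebra k)))
      (g := WithConv.toConv (genericT k (SweedlerAlgebra k)))
      (h := WithConv.toConv (genericTInv k (SweedlerAlgebra k)))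
      (k := WithConv.toConv (genericTInv k (SweedlerAlgebra k)))
    rw [genericT_mul_inv] at e2
    erw [e2] at e1
    apply WithConv.ofConv_injective
    refine e1.symm.trans ?_
    ext g h
    simp [LinearMap.convOne_def, mul_comm]
  have hα : WithConv.toConv (Algebra.linearMap k (GenericField k (SweedlerAlgebra k)) ∘ₗ α.form) *
      WithConv.toConv (Algebra.linearMap k (GenericField k (SweedlerAlgebra k)) ∘ₗ α.inv) = 1 := by
    have e1 := LinearMap.algHom_comp_convMul_distrib
      (Algebra.ofId k (GenericField k (SweedlerAlgebra k)))
      (WithConv.toConv α.form) (WithConv.toConv α.inv)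
    rw [α.form_mul_inv] at e1
    apply WithConv.ofConv_injective
    refine e1.symm.trans ?_
    ext g h
    simp [LinearMap.convOne_def, mul_comm]
  have hB : WithConv.toConv (genericTInv k (SweedlerAlgebra k) ∘ₗ
        LinearMap.mul' k (SweedlerAlgebra k)) *
      WithConv.toConv (genericT k (SweedlerAlgebra k) ∘ₗ
        LinearMap.mul' k (SweedlerAlgebra k)) = 1 := by
    have e1 := LinearMap.convMul_comp_coalgHom_distrib
      (WithConv.toConv (genericTInv k (SweedlerAlgebra k)))
      (WithConv.toConv (genericT k (SweedlerAlgebra k)))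
      (Bialgebra.mulCoalgHom k (SweedlerAlgebra k))
    rw [genericTInv_mul] at e1
    apply WithConv.ofConv_injective
    refine e1.symm.trans ?_
    ext g h
    simp [LinearMap.convOne_def, mul_comm]
  rw [genericCocycle, genericCocycleInv, WithConv.toConv_ofConv, WithConv.toConv_ofConv]
  simp only [mul_assoc]
  rw [← mul_assoc (WithConv.toConv (genericTInv k (SweedlerAlgebra k) ∘ₗ _)), hB, one_mul,
    ← mul_assoc (WithConv.toConv (Algebra.linearMap k _ ∘ₗ α.form)), hα, one_mul, hA]

end Cocycle

/-! ### The generic base algebra is the base subalgebra -/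

section BaseAlgebra

/-- Grouplike elements among `1, x`. -/
def IsOneOrX (g : SweedlerAlgebra k) : Prop := g = 1 ∨ g = x k

theorem IsOneOrX.comul {g : SweedlerAlgebra k} (hg : IsOneOrX g) :
    Coalgebra.comul (R := k) g = g ⊗ₜ g := by
  rcases hg with rfl | rfl
  · exact Bialgebra.comul_one
  · exact comul_x k

/-- The skew primitive elements among `y, z`. -/
def IsSkew (s g g' : SweedlerAlgebra k) : Prop :=
  IsOneOrX g ∧ IsOneOrX g' ∧ Coalgebra.comul (R := k) s = g ⊗ₜ s + s ⊗ₜ g' ∧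
    Coalgebra.counit (R := k) s = 0

theorem isSkew_y : IsSkew (y k) 1 (x k) := ⟨.inl rfl, .inr rfl, comul_y k, counit_y k⟩

theorem isSkew_z : IsSkew (z k) (x k) 1 := ⟨.inr rfl, .inl rfl, comul_z k, counit_z k⟩

/-- A submodule containing the products of basis elements is everything. -/
theorem tensor_mem_of_basis (S : Submodule k (SweedlerAlgebra k ⊗[k] SweedlerAlgebra k))
    (h0 : ∀ g h : SweedlerAlgebra k, IsOneOrX g → IsOneOrX h → g ⊗ₜ h ∈ S)
    (h1 : ∀ s g g' h : SweedlerAlgebra k, IsSkew s g g' → IsOneOrX h → s ⊗ₜ h ∈ S)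
    (h2 : ∀ g s h h' : SweedlerAlgebra k, IsOneOrX g → IsSkew s h h' → g ⊗ₜ s ∈ S)
    (h3 : ∀ s g g' r h h' : SweedlerAlgebra k, IsSkew s g g' → IsSkew r h h' → s ⊗ₜ r ∈ S)
    (t : SweedlerAlgebra k ⊗[k] SweedlerAlgebra k) : t ∈ S := by
  have dec : ∀ h : SweedlerAlgebra k,
      h = h.re • (1 : SweedlerAlgebra k) + h.imI • x k + h.imJ • y k + h.imK • z k := by
    intro h
    ext <;> simp [x, y, z]
  have comb : ∀ (f : SweedlerAlgebra k →ₗ[k] SweedlerAlgebra k ⊗[k] SweedlerAlgebra k),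
      f 1 ∈ S → f (x k) ∈ S → f (y k) ∈ S → f (z k) ∈ S → ∀ h, f h ∈ S := by
    intro f f1 fx fy fz h
    rw [dec h]
    simp only [map_add, map_smul]
    exact add_mem (add_mem (add_mem (S.smul_mem _ f1) (S.smul_mem _ fx)) (S.smul_mem _ fy))
      (S.smul_mem _ fz)
  have right : ∀ g, (IsOneOrX g ∨ ∃ p q, IsSkew g p q) → ∀ h, g ⊗ₜ[k] h ∈ S := by
    rintro g (hg | ⟨p, q, hg⟩)
    · exact comb (TensorProduct.mk k _ _ g) (h0 _ _ hg (.inl rfl)) (h0 _ _ hg (.inr rfl))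
        (h2 _ _ _ _ hg isSkew_y) (h2 _ _ _ _ hg isSkew_z)
    · exact comb (TensorProduct.mk k _ _ g) (h1 _ _ _ _ hg (.inl rfl)) (h1 _ _ _ _ hg (.inr rfl))
        (h3 _ _ _ _ _ _ hg isSkew_y) (h3 _ _ _ _ _ _ hg isSkew_z)
  induction t with
  | zero => exact zero_mem S
  | add a b ha hb => exact add_mem ha hb
  | tmul g h =>
    exact comb ((TensorProduct.mk k _ _).flip h) (right _ (.inl (.inl rfl)) h)
      (right _ (.inl (.inr rfl)) h) (right _ (.inr ⟨_, _, isSkew_y⟩) h)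
      (right _ (.inr ⟨_, _, isSkew_z⟩) h) g

/-- If a linear map has values in a subalgebra, as well as the inverses of its values on products
of grouplike elements, then its convolution inverse has values in that subalgebra. -/
theorem conv_inverse_mem {K : Type v} [Field K] [Algebra k K] (S : Subalgebra k K)
    (f f' : SweedlerAlgebra k ⊗[k] SweedlerAlgebra k →ₗ[k] K)
    (hf : WithConv.toConv f * WithConv.toConv f' = 1) (hS : ∀ t, f t ∈ S)
    (hinv : ∀ g h : SweedlerAlgebra k, IsOneOrX g → IsOneOrX h → (f (g ⊗ₜ h))⁻¹ ∈ S)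
    (t : SweedlerAlgebra k ⊗[k] SweedlerAlgebra k) : f' t ∈ S := by
  have ev := conv_apply hf
  have counitOne : ∀ g : SweedlerAlgebra k, IsOneOrX g → Coalgebra.counit (R := k) g = 1 := by
    rintro g (rfl | rfl)
    · exact Bialgebra.counit_one
    · exact counit_x k
  have h0 : ∀ g h : SweedlerAlgebra k, IsOneOrX g → IsOneOrX h →
      f (g ⊗ₜ h) * f' (g ⊗ₜ h) = 1 := by
    intro g h hg hh
    have := ev (g ⊗ₜ h)
    simpa [TensorProduct.comul_tmul, hg.comul, hh.comul, counitOne g hg, counitOne h hh] using this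
  have h0' : ∀ g h : SweedlerAlgebra k, IsOneOrX g → IsOneOrX h → f' (g ⊗ₜ h) ∈ S := by
    intro g h hg hh
    rw [eq_inv_of_mul_eq_one_right (h0 g h hg hh)]
    exact hinv g h hg hh
  -- In the convolution identity the unknown value of `f'` is multiplied by `f` at a product of
  -- grouplikes, which is invertible in `S`. The rest, `p`, involves `f'` only at tensors with fewer
  -- skew primitive factors.
  have solve : ∀ (g h : SweedlerAlgebra k), IsOneOrX g → IsOneOrX h → ∀ (p r : K), p ∈ S →
      f (g ⊗ₜ h) * r + p = 0 → r ∈ S := by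
    intro g h hg hh p r hp e
    have hne : f (g ⊗ₜ h) ≠ 0 := left_ne_zero_of_mul_eq_one (h0 g h hg hh)
    have : r = -((f (g ⊗ₜ h))⁻¹ * p) := by
      field_simp
      linear_combination e
    rw [this]
    exact neg_mem (mul_mem (hinv g h hg hh) hp)
  have h1' : ∀ s g g' h : SweedlerAlgebra k, IsSkew s g g' → IsOneOrX h → f' (s ⊗ₜ h) ∈ S := by
    rintro s g g' h ⟨hg, hg', hs, hs0⟩ hh
    have := ev (s ⊗ₜ h)
    simp only [TensorProduct.comul_tmul, hs, hh.comul, TensorProduct.add_tmul, map_add,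
      TensorProduct.AlgebraTensorModule.tensorTensorTensorComm_tmul, TensorProduct.map_tmul,
      LinearMap.mul'_apply, TensorProduct.counit_tmul, hs0, smul_zero, map_zero] at this
    exact solve g h hg hh _ _ (mul_mem (hS _) (h0' _ _ hg' hh)) this
  have h2' : ∀ g s h h' : SweedlerAlgebra k, IsOneOrX g → IsSkew s h h' → f' (g ⊗ₜ s) ∈ S := by
    rintro g s h h' hg ⟨hh, hh', hs, hs0⟩
    have := ev (g ⊗ₜ s)
    simp only [TensorProduct.comul_tmul, hs, hg.comul, TensorProduct.tmul_add, map_add,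
      TensorProduct.AlgebraTensorModule.tensorTensorTensorComm_tmul, TensorProduct.map_tmul,
      LinearMap.mul'_apply, TensorProduct.counit_tmul, hs0, zero_smul, map_zero] at this
    exact solve g h hg hh _ _ (mul_mem (hS _) (h0' _ _ hg hh')) this
  have h3' : ∀ s g g' r h h' : SweedlerAlgebra k, IsSkew s g g' → IsSkew r h h' →
      f' (s ⊗ₜ r) ∈ S := by
    intro s g g' r h h' hs hr
    have ms := h1' s g g' h' hs hr.2.1
    have mr := h2' g' r h h' hs.2.1 hr
    obtain ⟨hg, hg', hs, hs0⟩ := hs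
    obtain ⟨hh, hh', hr, hr0⟩ := hr
    have := ev (s ⊗ₜ r)
    simp only [TensorProduct.comul_tmul, hs, hr, TensorProduct.tmul_add, TensorProduct.add_tmul,
      map_add, TensorProduct.AlgebraTensorModule.tensorTensorTensorComm_tmul,
      TensorProduct.map_tmul, LinearMap.mul'_apply, TensorProduct.counit_tmul, hs0, hr0, smul_zero,
      map_zero] at this
    refine solve g h hg hh (f (s ⊗ₜ h) * f' (g' ⊗ₜ r) + (f (g ⊗ₜ r) * f' (s ⊗ₜ h') +
      f (s ⊗ₜ r) * f' (g' ⊗ₜ h'))) _ ?_ (by linear_combination this)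
    exact add_mem (mul_mem (hS _) mr) (add_mem (mul_mem (hS _) ms)
      (mul_mem (hS _) (h0' _ _ hg' hh')))
  exact tensor_mem_of_basis (S.toSubmodule.comap f') h0' h1' h2' h3' t

variable (α : TwoCocycle k (SweedlerAlgebra k))

theorem genericCocycleInv_eq_inv (g h : SweedlerAlgebra k) (hg : IsOneOrX g) (hh : IsOneOrX h) :
    genericCocycleInv α (g ⊗ₜ h) = (genericCocycle α (g ⊗ₜ h))⁻¹ := by
  have := conv_apply (genericCocycle_mul_inv α) (g ⊗ₜ h)
  apply eq_inv_of_mul_eq_one_right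
  rcases hg with rfl | rfl <;> rcases hh with rfl | rfl <;>
  simpa [TensorProduct.comul_tmul, comul_x, counit_x, Algebra.TensorProduct.one_def] using this

/-- For `σ⁻¹` in the base, `conv_inverse_mem` needs only the inverses of `σ` on grouplikes, which
are `t_1⁻¹` and `t_1 R⁻¹`. Conversely `σ(1, 1) = t_1`, and the other four values are recovered from
products of generators. -/
theorem genericBaseAlgebra_eq (h2 : (2 : k) ≠ 0) : genericBaseAlgebra α =
    baseSubalgebra α (genericT k (SweedlerAlgebra k)) := by
  have h1 := genericT_one_ne_zero (k := k)
  have hx := genericT_x_ne_zero (k := k)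
  apply le_antisymm
  · have hσ : ∀ t, genericCocycle α t ∈ baseSubalgebra α (genericT k (SweedlerAlgebra k)) := by
      intro t
      induction t with
      | zero => rw [map_zero]; exact zero_mem _
      | add a b ha hb => rw [map_add]; exact add_mem ha hb
      | tmul g h => exact genericCocycle_mem_base α h2 g h
    rw [genericBaseAlgebra, Algebra.adjoin_le_iff]
    rintro _ (⟨p, rfl⟩ | ⟨p, rfl⟩)
    · exact hσ _
    · refine conv_inverse_mem _ _ _ (genericCocycle_mul_inv α) hσ ?_ _
      obtain ⟨hE, hR⟩ := pointValue_inv_mem_base α (genericT k (SweedlerAlgebra k))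
      rintro g h (rfl | rfl) (rfl | rfl)
      · rw [genericCocycle_one_one α h2]
        exact hE
      · rw [genericCocycle_one_x α h2]
        exact hE
      · rw [genericCocycle_x_one α h2]
        exact hE
      · rw [genericCocycle_x_x α h2, mul_inv, inv_inv]
        exact mul_mem hR (one_mem_base α _)
  · have m : ∀ g h : SweedlerAlgebra k, genericCocycle α (g ⊗ₜ h) ∈ genericBaseAlgebra α :=
      fun g h => Algebra.subset_adjoin (.inl ⟨(g, h), rfl⟩)
    have mi : ∀ g h : SweedlerAlgebra k, genericCocycleInv α (g ⊗ₜ h) ∈ genericBaseAlgebra α :=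
      fun g h => Algebra.subset_adjoin (.inr ⟨(g, h), rfl⟩)
    have hE := m 1 1
    rw [genericCocycle_one_one α h2] at hE
    have hE' := mi 1 1
    rw [genericCocycleInv_eq_inv α _ _ (.inl rfl) (.inl rfl), genericCocycle_one_one α h2] at hE'
    have div : ∀ {p q : GenericField k (SweedlerAlgebra k)}, q ∈ genericBaseAlgebra α →
        q = p * (genericT k (SweedlerAlgebra k) 1)⁻¹ → p ∈ genericBaseAlgebra α := by
      intro p q hq e
      have := mul_mem hq hE
      rwa [e, inv_mul_cancel_right₀ h1] at this
    have hR := div (m _ _) (genericCocycle_x_x α h2)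
    -- Since `σ⁻¹(x, x) = t_1 R⁻¹`, multiplication by `t_1⁻¹` leaves `R⁻¹`.
    have hR' := mul_mem hE' (mi (x k) (x k))
    rw [genericCocycleInv_eq_inv α _ _ (.inr rfl) (.inr rfl), genericCocycle_x_x α h2, mul_inv,
      inv_inv, mul_comm, mul_assoc, mul_inv_cancel₀ h1, mul_one] at hR'
    refine base_le_of_pointValue α h2 _ hx _ ?_ hE' hR'
    rintro (_ | _)
    · exact hE
    · exact hR
    · exact div (m _ _) (genericCocycle_y_y α h2)
    · exact div (add_mem (m _ _) (m _ _)) (genericCocycle_x_y_add α h2)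
    · rw [← genericCocycle_x_z_add α h2]
      exact mul_mem hR (add_mem (m _ _) (m _ _))

end BaseAlgebra

/-! ### Comparison with `A_{a,b,c}` -/

section Discriminant

variable (α : TwoCocycle k (SweedlerAlgebra k))

theorem smul_one_injective {r s : k} (h : r • (1 : TwistedAlgebra α) = s • 1) : r = s := by
  rw [← u_one, ← map_smul, ← map_smul] at h
  simpa using congrArg QuaternionAlgebra.re ((u α).injective h)

/-- The inverse of a colinear isomorphism is colinear, so cofreeness of `ᵅH` determines `φ⁻¹(p)`
from the coaction of `p`. This pins down the images of the generators. -/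
theorem coaction_symm {a b c : k} (φ : TwistedAlgebra α ≃ₐ[k] SweedlerTwist a b c)
    (hφ : IsComoduleAlgHom k (SweedlerAlgebra k) φ.toAlgHom) (p : SweedlerTwist a b c) :
    φ.symm p = counitTensor α (Algebra.TensorProduct.map φ.symm.toAlgHom
      (AlgHom.id k (SweedlerAlgebra k)) (SweedlerTwist.coactionHom a b c p)) := by
  have h : SweedlerTwist.coactionHom a b c (φ (φ.symm p)) = _ := AlgHom.congr_fun hφ (φ.symm p)
  rw [AlgEquiv.apply_symm_apply] at h
  have inv : ∀ t : TwistedAlgebra α ⊗[k] SweedlerAlgebra k,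
      Algebra.TensorProduct.map φ.symm.toAlgHom (AlgHom.id k (SweedlerAlgebra k))
        (Algebra.TensorProduct.map φ.toAlgHom (AlgHom.id k (SweedlerAlgebra k)) t) = t := by
    intro t
    induction t with
    | zero => simp
    | add a b ha hb => simp only [map_add, ha, hb]
    | tmul a b => simp
  rw [h, AlgHom.comp_apply, inv, counitTensor_coaction]

/-- The discriminants of `ᵅH₄` and `A_{a,b,c}` agree. -/
theorem discriminant_eq (h2 : (2 : k) ≠ 0) {a b c : k} (ha : a ≠ 0)
    (φ : TwistedAlgebra α ≃ₐ[k] SweedlerTwist a b c)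
    (hφ : IsComoduleAlgHom k (SweedlerAlgebra k) φ.toAlgHom) :
    (b ^ 2 - 4 * a * c) / a = -4 * sqJ α := by
  have ha' := sqX_ne_zero α
  obtain ⟨l, hl⟩ : ∃ l : k, φ.symm (SweedlerTwist.ux a b c) = l • u α (x k) := by
    refine ⟨Coalgebra.counit (R := k) ((u α).symm (φ.symm (SweedlerTwist.ux a b c))),
      (coaction_symm α φ hφ _).trans ?_⟩
    rw [SweedlerTwist.coactionHom_ux]
    simp [counitTensor]
  -- The coefficient of `u_y` is 1 because the term `1 ⊗ y` of the coaction has first leg 1.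
  obtain ⟨n, hn⟩ : ∃ n : k, φ.symm (SweedlerTwist.uy a b c) = u α (y k) + n • u α (x k) := by
    refine ⟨Coalgebra.counit (R := k) ((u α).symm (φ.symm (SweedlerTwist.uy a b c))),
      (coaction_symm α φ hφ _).trans ?_⟩
    rw [SweedlerTwist.coactionHom_uy]
    have : (u α).symm 1 = 1 := rfl
    simp [counitTensor, this]
  have e1 := congrArg φ.symm (SweedlerTwist.ux_mul_ux a b c)
  have e2 := congrArg φ.symm (SweedlerTwist.ux_mul_uy_add a b c)
  have e3 := congrArg φ.symm (SweedlerTwist.uy_mul_uy a b c)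
  rw [map_mul, hl, AlgEquiv.commutes, Algebra.algebraMap_eq_smul_one, smul_mul_smul_comm,
    u_x_mul_u_x, smul_smul] at e1
  have e2' := sub_smul_mul_add (-n) (u α (x k)) (u α (y k))
  have e3' := sub_smul_mul_self (-n) (u α (x k)) (u α (y k))
  rw [neg_smul, sub_neg_eq_add, u_x_mul_u_y_add, u_x_mul_u_x, smul_smul, ← sub_smul] at e2'
  rw [neg_smul, sub_neg_eq_add, u_x_mul_u_y_add, u_x_mul_u_x, u_y_mul_u_y, smul_smul, smul_smul,
    ← sub_smul, ← add_smul] at e3'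
  rw [map_add, map_mul, map_mul, hl, hn, AlgEquiv.commutes, Algebra.algebraMap_eq_smul_one,
    smul_mul_assoc, mul_smul_comm, ← smul_add, add_comm (u α (x k) * _), e2', smul_smul] at e2
  rw [map_mul, hn, AlgEquiv.commutes, Algebra.algebraMap_eq_smul_one, e3'] at e3
  -- The three equations are `a = l² a'`, `b = l (b' + 2n a')` and `c = c' + n b' + n² a'`. Hence
  -- `b² - 4ac = l² (b'² - 4a'c')`, and dividing by `a` removes `l`.
  have f1 := smul_one_injective α e1
  have f2 := smul_one_injective α e2
  have f3 := smul_one_injective α e3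
  have hl0 : l ≠ 0 := by
    rintro rfl
    simp at f1
    exact ha f1.symm
  rw [← f1, ← f2, ← f3, sqJ]
  have h4 : (4 : k) = 2 * 2 := by norm_num
  rw [h4]
  field_simp
  ring

end Discriminant

/-! ### The algebra `k[E, E⁻¹, R, R⁻¹, S, T, U] / (D_{a,b,c})` -/

section Model

variable (α : TwoCocycle k (SweedlerAlgebra k))

/-- The algebraically independent variables `E, R, T, U`. -/
def freeVar : Fin 4 → SweedlerVar := ![.E, .R, .T, .U]

/-- The fibres of `s ↦ a s²` have at most two elements, so a finite image would make `k` finite. -/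
theorem infinite_mul_sq [Infinite k] {a : k} (ha : a ≠ 0) :
    {r : k | ∃ s, s ≠ 0 ∧ a * s ^ 2 = r}.Infinite := by
  intro hfin
  have h := hfin.preimage' (f := fun s : k => a * s ^ 2) (by
    rintro r ⟨s, -, rfl⟩
    refine (Set.toFinite {s, -s}).subset fun s' hs' => ?_
    have : s' ^ 2 = s ^ 2 := mul_left_cancel₀ ha hs'
    rcases sq_eq_sq_iff_eq_or_eq_neg.1 this with rfl | rfl <;> simp)
  refine (h.union (Set.finite_singleton (0 : k))).not_infinite ?_
  convert Set.infinite_univ (α := k)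
  ext s
  by_cases hs : s = 0
  · simp [hs]
  · simp only [Set.mem_union, Set.mem_univ, iff_true]
    exact .inl ⟨s, hs, rfl⟩

/-- Every tuple `(E, R, T, U)` with `R / u_x²` a nonzero square is attained at a point. -/
theorem exists_pointValue (h2 : (2 : k) ≠ 0) (v : Fin 4 → k) (s : k) (hs : s ≠ 0)
    (hv : sqX α * s ^ 2 = v 1) :
    ∃ τ : SweedlerAlgebra k →ₗ[k] k, ∀ i, pointValue α τ (freeVar i) = v i := by
  have ha := sqX_ne_zero α
  let τ : SweedlerAlgebra k →ₗ[k] k :=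
    -- With `τ(x) = s`, the values of `T` and `U` force `coordY` and `coordZ`; subtracting the
    -- shifts gives `τ(y)` and `τ(z)`.
    { toFun := fun h => h.re * v 0 + h.imI * s +
        h.imJ * (v 2 / (2 * sqX α * s) - shiftY α * v 0) +
        h.imK * (v 3 / (2 * sqX α * s ^ 2) - shiftZ α * s)
      map_add' := fun g h => by
        simp only [QuaternionAlgebra.re_add, QuaternionAlgebra.imI_add, QuaternionAlgebra.imJ_add,
          QuaternionAlgebra.imK_add]
        ring
      map_smul' := fun r h => by
        simp only [QuaternionAlgebra.re_smul, QuaternionAlgebra.imI_smul,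
          QuaternionAlgebra.imJ_smul, QuaternionAlgebra.imK_smul, smul_eq_mul, RingHom.id_apply]
        ring }
  have t1 : τ 1 = v 0 := by simp [τ]
  have tx : τ (x k) = s := by simp [τ, x]
  have ty : τ (y k) = v 2 / (2 * sqX α * s) - shiftY α * v 0 := by simp [τ, y]
  have tz : τ (z k) = v 3 / (2 * sqX α * s ^ 2) - shiftZ α * s := by simp [τ, z]
  refine ⟨τ, fun i => ?_⟩
  fin_cases i
  · simpa [freeVar, pointValue] using t1
  · simpa [freeVar, pointValue, tx] using hv
  · simp [freeVar, pointValue, coordY, t1, tx, ty]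
    field_simp
  · simp [freeVar, pointValue, coordZ, tx, tz]
    field_simp

/-- The values of `E`, `R`, `T`, `U` at the generic point are algebraically independent. -/
theorem algebraicIndependent_pointValue [Infinite k] (h2 : (2 : k) ≠ 0) :
    AlgebraicIndependent k fun i => pointValue α (genericT k (SweedlerAlgebra k)) (freeVar i) := by
  rw [algebraicIndependent_iff]
  intro p hp
  -- The relation is pulled back to `S(t_H)`, where specialization at `τ` makes sense.
  have hS : MvPolynomial.aeval
      (fun i => pointValue α (SymmetricAlgebra.ι k (SweedlerAlgebra k)) (freeVar i)) p = 0 := by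
    apply genericField_algebraMap_injective
    rw [map_zero, ← hp]
    have := MvPolynomial.comp_aeval_apply (fun i => pointValue α (SymmetricAlgebra.ι k
      (SweedlerAlgebra k)) (freeVar i)) (IsScalarTower.toAlgHom k (SymmetricAlgebra k
      (SweedlerAlgebra k)) (GenericField k (SweedlerAlgebra k))) p
    simp only [map_pointValue] at this
    exact this
  -- Over `k` the variable `R` only takes values in `a'` times nonzero squares. That set is
  -- infinite, which is enough for a polynomial to vanish.
  apply MvPolynomial.funext_set
    ![Set.univ, {r | ∃ s, s ≠ 0 ∧ sqX α * s ^ 2 = r}, Set.univ, Set.univ]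
  · intro i
    fin_cases i
    · exact Set.infinite_univ
    · exact infinite_mul_sq (sqX_ne_zero α)
    · exact Set.infinite_univ
    · exact Set.infinite_univ
  · intro v hv
    obtain ⟨s, hs, hvs⟩ := hv 1 (Set.mem_univ _)
    obtain ⟨τ, hτ⟩ := exists_pointValue α h2 v s hs hvs
    have := congrArg (SymmetricAlgebra.lift τ) hS
    rw [MvPolynomial.comp_aeval_apply, map_zero] at this
    simp only [map_pointValue] at this
    rw [show (SymmetricAlgebra.lift τ).toLinearMap ∘ₗ SymmetricAlgebra.ι k _ = τ from
      SymmetricAlgebra.lift_comp_ι τ, funext hτ] at this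
    rw [map_zero, ← this, MvPolynomial.aeval_eq_eval]

end Model

/-! ### Elimination of `S` and clearing of denominators in the model. -/

section ModelNormalForm

variable (a b c : k)

theorem sweedlerLaurent_isUnit (i : SweedlerVar) (hi : i = .E ∨ i = .R) :
    IsUnit (SweedlerLaurent.var k i) := by
  refine IsLocalization.map_units (M := Submonoid.closure
    {(MvPolynomial.X SweedlerVar.E : MvPolynomial SweedlerVar k), MvPolynomial.X SweedlerVar.R})
    (SweedlerLaurent k) ⟨MvPolynomial.X i, Submonoid.subset_closure ?_⟩
  rcases hi with rfl | rfl <;> simp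

theorem model_isUnit (n : ℕ) :
    IsUnit ((SweedlerCenterModel.var a b c .E * SweedlerCenterModel.var a b c .R) ^ n) :=
  (((sweedlerLaurent_isUnit _ (.inl rfl)).map _).mul
    ((sweedlerLaurent_isUnit _ (.inr rfl)).map _)).pow n

theorem model_relation :
    SweedlerCenterModel.var a b c .T ^ 2 -
      4 * SweedlerCenterModel.var a b c .R * SweedlerCenterModel.var a b c .S -
      ((b ^ 2 - 4 * a * c) / a) • (SweedlerCenterModel.var a b c .E ^ 2 *
        SweedlerCenterModel.var a b c .R) = 0 :=
  Ideal.Quotient.eq_zero_iff_mem.2 (Ideal.mem_span_singleton_self (sweedlerD a b c))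

/-- The polynomials in the variables `E, R, T, U` as elements of the model. -/
def freePart : MvPolynomial (Fin 4) k →ₐ[k] SweedlerCenterModel a b c :=
  MvPolynomial.aeval fun i => SweedlerCenterModel.var a b c (freeVar i)

/-- The class of a polynomial in `E, R, S, T, U`. -/
def polyClass : MvPolynomial SweedlerVar k →ₐ[k] SweedlerCenterModel a b c :=
  (Ideal.Quotient.mkₐ k (Ideal.span {sweedlerD a b c})).comp
    (IsScalarTower.toAlgHom k (MvPolynomial SweedlerVar k) (SweedlerLaurent k))

theorem polyClass_X (i : SweedlerVar) :
    polyClass a b c (MvPolynomial.X i) = SweedlerCenterModel.var a b c i := rfl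

theorem freePart_X (i : Fin 4) :
    freePart a b c (MvPolynomial.X i) = SweedlerCenterModel.var a b c (freeVar i) := by
  simp [freePart]

/-- Elements that become polynomials in `E, R, T, U` after multiplication by a power of `ER`. -/
def IsCleared (m : SweedlerCenterModel a b c) : Prop :=
  ∃ (n : ℕ) (p : MvPolynomial (Fin 4) k),
    (SweedlerCenterModel.var a b c .E * SweedlerCenterModel.var a b c .R) ^ n * m =
      freePart a b c p

variable {a b c}

theorem IsCleared.add {m m' : SweedlerCenterModel a b c} (h : IsCleared a b c m)
    (h' : IsCleared a b c m') : IsCleared a b c (m + m') := by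
  obtain ⟨n, p, hp⟩ := h
  obtain ⟨n', p', hp'⟩ := h'
  refine ⟨n + n', (MvPolynomial.X 0 * MvPolynomial.X 1) ^ n' * p +
    (MvPolynomial.X 0 * MvPolynomial.X 1) ^ n * p', ?_⟩
  rw [map_add, map_mul, map_mul, ← hp, ← hp', map_pow, map_pow, map_mul, freePart_X, freePart_X]
  change _ = (SweedlerCenterModel.var a b c .E * SweedlerCenterModel.var a b c .R) ^ n' * _ +
    (SweedlerCenterModel.var a b c .E * SweedlerCenterModel.var a b c .R) ^ n * _
  ring

theorem IsCleared.mul {m m' : SweedlerCenterModel a b c} (h : IsCleared a b c m)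
    (h' : IsCleared a b c m') : IsCleared a b c (m * m') := by
  obtain ⟨n, p, hp⟩ := h
  obtain ⟨n', p', hp'⟩ := h'
  refine ⟨n + n', p * p', ?_⟩
  rw [map_mul, ← hp, ← hp']
  ring

theorem isCleared_freePart (p : MvPolynomial (Fin 4) k) : IsCleared a b c (freePart a b c p) :=
  ⟨0, p, by rw [pow_zero, one_mul]⟩

theorem isCleared_var (h2 : (2 : k) ≠ 0) (i : SweedlerVar) :
    IsCleared a b c (SweedlerCenterModel.var a b c i) := by
  have free : ∀ j, IsCleared a b c (SweedlerCenterModel.var a b c (freeVar j)) := by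
    intro j
    rw [← freePart_X]
    exact isCleared_freePart _
  cases i with
  | E => exact free 0
  | R => exact free 1
  | T => exact free 2
  | U => exact free 3
  | S =>
    -- The relation gives `4RS = T² - ((b² - 4ac)/a) E²R`; multiplying by `E` yields `ER · S`.
    refine ⟨1, (4 : k)⁻¹ • (MvPolynomial.X 0 * (MvPolynomial.X 2 ^ 2 -
      ((b ^ 2 - 4 * a * c) / a) • (MvPolynomial.X 0 ^ 2 * MvPolynomial.X 1))), ?_⟩
    have h4 : (4 : k) ≠ 0 := by
      have : (4 : k) = 2 * 2 := by norm_num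
      rw [this]
      exact mul_ne_zero h2 h2
    have rel := model_relation a b c
    rw [pow_one, map_smul, eq_inv_smul_iff₀ h4, map_mul, map_sub, map_smul, map_mul, map_pow,
      map_pow, freePart_X, freePart_X, freePart_X]
    change _ = SweedlerCenterModel.var a b c .E * (SweedlerCenterModel.var a b c .T ^ 2 -
      ((b ^ 2 - 4 * a * c) / a) • (SweedlerCenterModel.var a b c .E ^ 2 *
        SweedlerCenterModel.var a b c .R))
    have e4 : ∀ m : SweedlerCenterModel a b c, (4 : k) • m = 4 * m := by
      intro m
      exact (Algebra.smul_def (4 : k) m).trans (by rw [map_ofNat])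
    rw [e4]
    linear_combination (-SweedlerCenterModel.var a b c .E) * rel

theorem isCleared_polyClass (h2 : (2 : k) ≠ 0) (p : MvPolynomial SweedlerVar k) :
    IsCleared a b c (polyClass a b c p) := by
  induction p using MvPolynomial.induction_on with
  | C r =>
    have := isCleared_freePart (a := a) (b := b) (c := c) (MvPolynomial.C r)
    rw [← MvPolynomial.algebraMap_eq, AlgHom.commutes] at this ⊢
    exact this
  | add p q hp hq =>
    rw [map_add]
    exact hp.add hq
  | mul_X p i hp =>
    rw [map_mul, polyClass_X]
    exact hp.mul (isCleared_var h2 i)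

theorem isCleared (h2 : (2 : k) ≠ 0) (m : SweedlerCenterModel a b c) : IsCleared a b c m := by
  obtain ⟨l, rfl⟩ := Ideal.Quotient.mk_surjective m
  obtain ⟨⟨q, s⟩, hq⟩ := IsLocalization.surj (Submonoid.closure
    {(MvPolynomial.X SweedlerVar.E : MvPolynomial SweedlerVar k), MvPolynomial.X SweedlerVar.R}) l
  -- Every denominator divides a power of `ER`, so powers of this one element suffice.
  have hdiv : ∃ (n : ℕ) (t : MvPolynomial SweedlerVar k),
      t * (s : MvPolynomial SweedlerVar k) =
        (MvPolynomial.X SweedlerVar.E * MvPolynomial.X SweedlerVar.R) ^ n := by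
    obtain ⟨s, hs⟩ := s
    change ∃ (n : ℕ) (t : MvPolynomial SweedlerVar k), t * s = _
    clear hq
    induction hs using Submonoid.closure_induction with
    | mem s hs =>
      rcases hs with rfl | rfl
      · exact ⟨1, MvPolynomial.X .R, by ring⟩
      · exact ⟨1, MvPolynomial.X .E, by ring⟩
    | one => exact ⟨0, 1, by ring⟩
    | mul s s' _ _ hs hs' =>
      obtain ⟨n, t, ht⟩ := hs
      obtain ⟨n', t', ht'⟩ := hs'
      refine ⟨n + n', t * t', ?_⟩
      rw [pow_add, ← ht, ← ht']
      ring
  obtain ⟨n, t, ht⟩ := hdiv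
  obtain ⟨n', p, hp⟩ := isCleared_polyClass (a := a) (b := b) (c := c) h2 (t * q)
  refine ⟨n' + n, p, ?_⟩
  have e1 : Ideal.Quotient.mk (Ideal.span {sweedlerD a b c}) l * polyClass a b c s =
      polyClass a b c q := congrArg (Ideal.Quotient.mk (Ideal.span {sweedlerD a b c})) hq
  have e2 := congrArg (polyClass a b c) ht
  rw [map_mul, map_pow, map_mul, polyClass_X, polyClass_X] at e2
  rw [map_mul, ← e1] at hp
  rw [← hp, pow_add, ← e2]
  ring

end ModelNormalForm

/-! ### The model embeds in `Frac S(t_H)`. -/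

section ModelHom

variable (α : TwoCocycle k (SweedlerAlgebra k)) {a b c : k}

theorem aeval_pointValue_ne_zero :
    MvPolynomial.aeval (R := k) (pointValue α (genericT k (SweedlerAlgebra k)))
      (MvPolynomial.X .E) ≠ 0 ∧
    MvPolynomial.aeval (R := k) (pointValue α (genericT k (SweedlerAlgebra k)))
      (MvPolynomial.X .R) ≠ 0 := by
  rw [MvPolynomial.aeval_X, MvPolynomial.aeval_X]
  exact pointValue_ne_zero α _ genericT_one_ne_zero genericT_x_ne_zero

/-- The map from `k[E, E⁻¹, R, R⁻¹, S, T, U]` to `Frac S(t_H)` given by the generic point. -/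
def laurentHom : SweedlerLaurent k →ₐ[k] GenericField k (SweedlerAlgebra k) :=
  localizationHom (MvPolynomial.aeval (pointValue α (genericT k (SweedlerAlgebra k)))) _ _
    (aeval_pointValue_ne_zero α).1 (aeval_pointValue_ne_zero α).2

theorem laurentHom_var (i : SweedlerVar) : laurentHom α (SweedlerLaurent.var k i) =
    pointValue α (genericT k (SweedlerAlgebra k)) i :=
  (localizationHom_algebraMap _ _ _ _ _ _).trans (MvPolynomial.aeval_X _ i)

/-- In `T² - 4RS` the terms in `v²` cancel, leaving `-4d E² R` with `d = sqJ`. -/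
theorem laurentHom_sweedlerD (hd : (b ^ 2 - 4 * a * c) / a = -4 * sqJ α) :
    laurentHom α (sweedlerD a b c) = 0 := by
  have e4 : laurentHom α 4 = 4 := map_ofNat _ 4
  rw [sweedlerD, hd, map_sub, map_sub, map_smul, map_mul, map_mul, map_mul, map_pow, map_pow,
    laurentHom_var, laurentHom_var, laurentHom_var, laurentHom_var, e4, Algebra.smul_def, map_mul,
    map_neg, map_ofNat]
  simp only [pointValue]
  ring

/-- The map from the model of the localized center to `Frac S(t_H)`. -/
def modelHom (hd : (b ^ 2 - 4 * a * c) / a = -4 * sqJ α) :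
    SweedlerCenterModel a b c →ₐ[k] GenericField k (SweedlerAlgebra k) :=
  Ideal.Quotient.liftₐ _ (laurentHom α) fun d hd' => by
    have : Ideal.span {sweedlerD a b c} ≤ RingHom.ker (laurentHom α) := by
      rw [Ideal.span_singleton_le_iff_mem]
      exact laurentHom_sweedlerD α hd
    exact this hd'

theorem modelHom_var (hd : (b ^ 2 - 4 * a * c) / a = -4 * sqJ α) (i : SweedlerVar) :
    modelHom α hd (SweedlerCenterModel.var a b c i) =
      pointValue α (genericT k (SweedlerAlgebra k)) i :=
  laurentHom_var α i

/-- A power of the unit `ER` turns an element of the kernel into a polynomial in `E, R, T, U` alone,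
which is zero by algebraic independence. -/
theorem modelHom_injective [Infinite k] (h2 : (2 : k) ≠ 0)
    (hd : (b ^ 2 - 4 * a * c) / a = -4 * sqJ α) : Function.Injective (modelHom α hd) := by
  rw [injective_iff_map_eq_zero]
  intro m hm
  obtain ⟨n, p, hp⟩ := isCleared h2 m
  have h := congrArg (modelHom α hd) hp
  rw [map_mul, hm, mul_zero, freePart, MvPolynomial.comp_aeval_apply] at h
  simp only [modelHom_var] at h
  have hp0 : p = 0 :=
    (algebraicIndependent_iff.1 (algebraicIndependent_pointValue α h2)) p h.symm
  rw [hp0, map_zero] at hp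
  exact (model_isUnit a b c n).mul_right_eq_zero.1 hp

theorem range_modelHom [Infinite k] (h2 : (2 : k) ≠ 0)
    (hd : (b ^ 2 - 4 * a * c) / a = -4 * sqJ α) :
    (modelHom α hd).range = baseSubalgebra α (genericT k (SweedlerAlgebra k)) := by
  have hval : ∀ i, pointValue α (genericT k (SweedlerAlgebra k)) i ∈
      baseSubalgebra α (genericT k (SweedlerAlgebra k)) := by
    intro i
    rw [← centerHom_sweedlerClass h2 α i]
    exact centerHom_mem_base h2 α _
  apply le_antisymm
  · rintro _ ⟨m, rfl⟩
    obtain ⟨l, rfl⟩ := Ideal.Quotient.mk_surjective m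
    refine localizationHom_mem _ _ _ (aeval_pointValue_ne_zero α).1
      (aeval_pointValue_ne_zero α).2 _ (fun p => ?_) ?_ ?_ l
    · induction p using MvPolynomial.induction_on with
      | C r =>
        rw [MvPolynomial.aeval_C]
        exact Subalgebra.algebraMap_mem _ r
      | add p q hp hq =>
        rw [map_add]
        exact add_mem hp hq
      | mul_X p i hp =>
        rw [map_mul, MvPolynomial.aeval_X]
        exact mul_mem hp (hval i)
    · rw [MvPolynomial.aeval_X]
      exact (pointValue_inv_mem_base α _).1
    · rw [MvPolynomial.aeval_X]
      exact (pointValue_inv_mem_base α _).2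
  · have hinv : ∀ i : SweedlerVar, i = .E ∨ i = .R →
        (pointValue α (genericT k (SweedlerAlgebra k)) i)⁻¹ ∈ (modelHom α hd).range := by
      intro i hi
      obtain ⟨w, hw⟩ := (sweedlerLaurent_isUnit (k := k) i hi).exists_left_inv
      refine ⟨Ideal.Quotient.mk _ w, eq_inv_of_mul_eq_one_left ?_⟩
      have := congrArg (laurentHom α) hw
      rwa [map_mul, map_one, laurentHom_var] at this
    exact base_le_of_pointValue α h2 (genericT k (SweedlerAlgebra k)) genericT_x_ne_zero _
      (fun i => ⟨_, modelHom_var α hd i⟩) (hinv _ (.inl rfl)) (hinv _ (.inr rfl))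

end ModelHom

end SweedlerGeneric

end

theorem mainTheorem3 {k : Type*} [Field k] [Infinite k] (hk : ringChar k ≠ 2)
    (α : TwoCocycle k (SweedlerAlgebra k)) (a b c : k) (ha : a ≠ 0)
    (φ : TwistedAlgebra α ≃ₐ[k] SweedlerTwist a b c)
    (hφ : IsComoduleAlgHom k (SweedlerAlgebra k) φ.toAlgHom) :
    ∃ hZ : ∀ i : SweedlerVar, sweedlerClass α i ∈ sweedlerCenter α,
      (∃ Φ : SweedlerCenterLocalization α ⟨_, hZ .E⟩ ⟨_, hZ .R⟩ ≃ₐ[k] SweedlerCenterModel a b c,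
        ∀ i : SweedlerVar,
          Φ (algebraMap (sweedlerCenter α) _ ⟨_, hZ i⟩) = SweedlerCenterModel.var a b c i) ∧
      (∃ Ψ : SweedlerCenterLocalization α ⟨_, hZ .E⟩ ⟨_, hZ .R⟩ ≃ₐ[k] genericBaseAlgebra α,
        ∀ (P : TensorAlgebra k (SweedlerAlgebra k))
          (hP : universalMk k (SweedlerAlgebra k) (TwistedAlgebra α) P ∈ sweedlerCenter α),
          toGenericField α (universalMap α P) =
            (Ψ (algebraMap (sweedlerCenter α) _ ⟨_, hP⟩) :
              GenericField k (SweedlerAlgebra k)) ⊗ₜ[k] (1 : TwistedAlgebra α)) := by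
  have h2 : (2 : k) ≠ 0 := Ring.two_ne_zero hk
  have hd := SweedlerGeneric.discriminant_eq α h2 ha φ hφ
  -- Both isomorphisms come from comparing embeddings in `Frac S(t_H)` whose common image is the
  -- base subalgebra.
  have hinj := SweedlerGeneric.centerLocalizationHom_injective h2 α
  have hrange := SweedlerGeneric.range_centerLocalizationHom h2 α
  refine ⟨SweedlerGeneric.sweedlerClass_mem_center h2 α, ?_, ?_⟩
  · have hm := SweedlerGeneric.modelHom_injective α h2 hd
    refine ⟨SweedlerGeneric.equivOfRangeEq (SweedlerGeneric.centerLocalizationHom h2 α)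
      (SweedlerGeneric.modelHom α hd) hinj hm
      (hrange.trans (SweedlerGeneric.range_modelHom α h2 hd).symm), fun i => hm ?_⟩
    rw [SweedlerGeneric.apply_equivOfRangeEq, SweedlerGeneric.centerLocalizationHom_algebraMap,
      SweedlerGeneric.centerHom_sweedlerClass, SweedlerGeneric.modelHom_var]
  · have hg : Function.Injective (genericBaseAlgebra α).val := Subtype.val_injective
    have hr : (SweedlerGeneric.centerLocalizationHom h2 α).range =
        (genericBaseAlgebra α).val.range := by
      rw [Subalgebra.range_val, SweedlerGeneric.genericBaseAlgebra_eq α h2, hrange]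
    refine ⟨SweedlerGeneric.equivOfRangeEq (SweedlerGeneric.centerLocalizationHom h2 α)
      (genericBaseAlgebra α).val hinj hg hr, fun P hP => ?_⟩
    have := SweedlerGeneric.apply_equivOfRangeEq (SweedlerGeneric.centerLocalizationHom h2 α)
      (genericBaseAlgebra α).val hinj hg hr
      (algebraMap (sweedlerCenter α) _ ⟨universalMk k (SweedlerAlgebra k) (TwistedAlgebra α) P, hP⟩)
    rw [SweedlerGeneric.universalMap_center h2 α P hP,
      ← SweedlerGeneric.centerLocalizationHom_algebraMap, ← this]
    rfl
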